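/- **Setting.** There are $N\ge 1$ agents, $R\ge 1$ resources and $K\ge 1$ contexts. In the stage game every agent $n$ chooses an action $a_n$ in $\mathcal A=\{Y,A_1,\dots,A_R\}$ (yield, or access resource $r$). Its payoff is $0$ if it yields, $1$ if it is the only agent that accesses its resource (a *successful* access), and $\zeta<0$ if it collides with another agent. At time-steps $t=0,1,2,\dots$ all agents observe the context $k_t$; the contexts $1,\dots,K$ recur periodically, and one period is called an episode. **Learning rule.** Every agent $n$ has a strategy $g_n:\{1,\dots,K\}\to\mathcal A$ whose values are initially independent and uniform on $\mathcal A$, and a flag $accessed_n$, initially False. At a time-step with context $k$ all agents act simultaneously: * if $g_n(k)=A_r$ and $accessed_n$ is False, agent $n$ accesses $r$; on a collision it sets $g_n(k)\leftarrow Y$ with probability $p$, otherwise it sets $accessed_n\leftarrow$ True; * if $g_n(k)=Y$, agent $n$ yields and monitors a uniformly random resource $r$; if nobody accesses $r$ in this time-step, it sets $g_n(k)\leftarrow A_r$; * if $g_n(k)\ne Y$ and $accessed_n$ is True, agent $n$ yields and changes nothing. At the end of each episode all flags are reset to False. All random choices are independent. **Convergence.** A plan $\sigma$ assigns a joint action $\sigma(k)$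 to every context $k$. It respects the quota if every agent yields from its first successful access until the end of the episode. The plan $\sigma$ is an efficient correlated equilibrium for every context if: it respects the quota; no agent can increase its total payoff over the contexts by another choice of its actions as a function of the context that respects its quota; in every context, the action of each agent without an earlier success in the episode is a best response to the other agents' actions in that context; and the sum of all agents' payoffs over all contexts is maximal among the plans that respect the quota. (For $N\ge RK$ this maximum means that in every context all resources are used and there are no collisions.) Let $\tau\in\{0,1,2,\dots\}\cup\{\infty\}$ be the least $t$ such that, for some efficient correlated equilibrium $\sigma$ for every context, the joint action at every time-step $t'\ge t$ is $\sigma(k_{t'})$. **Theorem.** (1) There is an absolute constant $C>0$ such that for all $N,R,K\ge 1$, all $0<p<1$ and all $\zeta<0$, $$\mathbb E[\tau]\;\le\; C\left((K\log K+2K)\,R\,\frac{2-p}{2(1-p)}\Big(\frac1p\log N+R\Big)+1\right).$$ (2) For every $p\in(0,1)$ there is a constant $C_p>0$ such that for all $N,R\ge1$ and all $\zeta<0$, with $K=\lceil N/R\rceil$, $$\mathbb E[\tau]\;\le\; C_p\,N\left(\log\lceil N/R\rceil+1\right)\left(\log N+R\right).$$ -/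

import Mathlib

open MeasureTheory ProbabilityTheory
open scoped ENNReal

/-- The stage-game actions: `none` is yielding, `some r` is accessing resource `r`. -/
abbrev StageAction (R : ℕ) : Type := Option (Fin R)

/-- Agent `n` successfully accesses a resource under the joint action `a`: it accesses some
resource and nobody else accesses that resource. -/
def Succeeds {N R : ℕ} (a : Fin N → StageAction R) (n : Fin N) : Prop :=
  a n ≠ none ∧ ∀ i, i ≠ n → a i ≠ a n

/-- More than one agent accesses resource `r`. -/
def Collision {N R : ℕ} (a : Fin N → StageAction R) (r : Fin R) : Prop :=
  ∃ i j, i ≠ j ∧ a i = some r ∧ a j = some r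

/-- No agent accesses resource `r`. -/
def IsFree {N R : ℕ} (a : Fin N → StageAction R) (r : Fin R) : Prop :=
  ∀ i, a i ≠ some r

open Classical in
/-- The stage payoff: `0` for yielding, `1` for a successful access, the collision cost `ζ`
otherwise. -/
noncomputable def payoff {N R : ℕ} (ζ : ℝ) (a : Fin N → StageAction R) (n : Fin N) : ℝ :=
  if a n = none then 0 else if ∀ i, i ≠ n → a i ≠ a n then 1 else ζ

section Equilibrium

/-- A contextual plan: the joint action that the agents play on observing each context. -/
abbrev Plan (N R K : ℕ) : Type := Fin K → Fin N → StageAction R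

/-- During an episode the contexts are observed in increasing order. Agent `n` may still access a
resource in context `k` if it had no successful access earlier in the episode. -/
def Eligible {N R K : ℕ} (σ : Plan N R K) (k : Fin K) (n : Fin N) : Prop :=
  ∀ j, j < k → ¬ Succeeds (σ j) n

/-- Agent `n` respects the quota of one successful access per episode: after a successful access it
yields until the end of the episode. -/
def RespectsQuota {N R K : ℕ} (σ : Plan N R K) (n : Fin N) : Prop :=
  ∀ k, σ k n ≠ none → Eligible σ k n

/-- The plan in which agent `n` plays `d k` in context `k` and the others follow `σ`. -/
def deviate {N R K : ℕ} (σ : Plan N R K) (n : Fin N) (d : Fin K → StageAction R) : Plan N R K :=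
  fun k => Function.update (σ k) n (d k)

/-- Correlated equilibrium of the allocation game under the quota, the context (each value once per
episode) being the common signal. The plan is admissible and no agent can raise its total payoff
over the contexts by any admissible way of choosing its action as a function of the signal. -/
def IsCorrelatedEquilibrium {N R K : ℕ} (ζ : ℝ) (σ : Plan N R K) : Prop :=
  (∀ n, RespectsQuota σ n) ∧
    ∀ (n : Fin N) (d : Fin K → StageAction R), RespectsQuota (deviate σ n d) n →
      ∑ k, payoff ζ (deviate σ n d k) n ≤ ∑ k, payoff ζ (σ k) n

/-- In every single context, the action of every agent that may still access a resource is a best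
response to the actions of the others in that context. -/
def IsEquilibriumInEveryContext {N R K : ℕ} (ζ : ℝ) (σ : Plan N R K) : Prop :=
  ∀ (k : Fin K) (n : Fin N), Eligible σ k n →
    ∀ b : StageAction R, payoff ζ (Function.update (σ k) n b) n ≤ payoff ζ (σ k) n

/-- Efficiency: the total payoff of all agents over all contexts is the largest that any plan
respecting the quota achieves. -/
def IsEfficient {N R K : ℕ} (ζ : ℝ) (σ : Plan N R K) : Prop :=
  ∀ σ' : Plan N R K, (∀ n, RespectsQuota σ' n) →
    ∑ k, ∑ n, payoff ζ (σ' k) n ≤ ∑ k, ∑ n, payoff ζ (σ k) n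

/-- An efficient correlated equilibrium, for every context. -/
def IsEfficientEquilibrium {N R K : ℕ} (ζ : ℝ) (σ : Plan N R K) : Prop :=
  IsCorrelatedEquilibrium ζ σ ∧ IsEquilibriumInEveryContext ζ σ ∧ IsEfficient ζ σ

end Equilibrium

section LearningRule

/-- The memory of all agents: the strategies `g n : contexts → actions` and the flags
`accessed n`. -/
structure AgentState (N R K : ℕ) where
  g : Fin N → Fin K → StageAction R
  accessed : Fin N → Bool

/-- The joint action in context `k`: an agent accesses `r` iff `g n k = some r` and its flag is
not set. -/
def AgentState.jointAction {N R K : ℕ} (s : AgentState N R K) (k : Fin K) :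
    Fin N → StageAction R :=
  fun n => if s.accessed n then none else s.g n k

open Classical in
/-- One time-step of the learning rule in context `k`, all agents acting simultaneously. The
randomness `ξ n` of agent `n` consists of its back-off coin `(ξ n).1` and the resource `(ξ n).2`
that it monitors in case `g n k` is yielding. The flags are reset when the last context of the
episode has been processed. -/
noncomputable def AgentState.step {N R K : ℕ} (k : Fin K) (ξ : Fin N → Bool × Fin R)
    (s : AgentState N R K) : AgentState N R K where
  g := fun n => Function.update (s.g n) k <|
    match s.g n k with
    | some r =>
        if s.accessed n = false ∧ Collision (s.jointAction k) r ∧ (ξ n).1 = true then none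
        else some r
    | none => if IsFree (s.jointAction k) (ξ n).2 then some (ξ n).2 else none
  accessed := fun n =>
    if (k : ℕ) + 1 = K then false
    else s.accessed n || decide (Succeeds (s.jointAction k) n)

/-- The context observed at time-step `t`: the contexts recur periodically, each once per
episode. -/
def contextAt (K : ℕ) [NeZero K] (t : ℕ) : Fin K := Fin.ofNat K t

/-- The random source of a run: the initial strategies, and for every time-step and agent a
back-off coin and a resource to monitor. -/
abbrev Randomness (N R K : ℕ) : Type :=
  (Fin N → Fin K → StageAction R) × (ℕ → Fin N → Bool × Fin R)

/-- The state before time-step `t` (time-steps are numbered from `0`). -/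
noncomputable def stateAt {N R K : ℕ} [NeZero K] (ω : Randomness N R K) : ℕ → AgentState N R K
  | 0 => ⟨ω.1, fun _ => false⟩
  | t + 1 => (stateAt ω t).step (contextAt K t) (ω.2 t)

/-- The joint action played at time-step `t`. -/
noncomputable def actionAt {N R K : ℕ} [NeZero K] (ω : Randomness N R K) (t : ℕ) :
    Fin N → StageAction R :=
  (stateAt ω t).jointAction (contextAt K t)

/-- From time-step `t` on the agents forever play one fixed efficient correlated equilibrium. -/
def ConvergedAt {N R K : ℕ} [NeZero K] (ζ : ℝ) (ω : Randomness N R K) (t : ℕ) : Prop :=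
  ∃ σ : Plan N R K, IsEfficientEquilibrium ζ σ ∧
    ∀ t', t ≤ t' → actionAt ω t' = σ (contextAt K t')

/-- The number of time-steps before convergence (`∞` if the run does not converge). -/
noncomputable def convergenceTime {N R K : ℕ} [NeZero K] (ζ : ℝ) (ω : Randomness N R K) : ℝ≥0∞ :=
  ⨅ (t : ℕ) (_ : ConvergedAt ζ ω t), (t : ℝ≥0∞)

instance stageActionMeasurableSpace (R : ℕ) : MeasurableSpace (StageAction R) := ⊤

/-- The law of the random source: all coordinates are independent, the initial strategies are
uniform on the actions, the back-off coins are `true` with probability `p`, and the monitored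
resources are uniform on the resources. -/
noncomputable def runLaw (N R K : ℕ) [NeZero R] (p : unitInterval) :
    Measure (Randomness N R K) :=
  (Measure.pi fun _ : Fin N => Measure.pi fun _ : Fin K =>
      (PMF.uniformOfFintype (StageAction R)).toMeasure).prod
    (Measure.infinitePi fun _ : ℕ => Measure.pi fun _ : Fin N =>
      (bernoulliMeasure true false p).prod (PMF.uniformOfFintype (Fin R)).toMeasure)

/-- The expected number of time-steps before the learning rule converges. -/
noncomputable def expectedSteps (N R K : ℕ) [NeZero R] [NeZero K] (p : unitInterval) (ζ : ℝ) :
    ℝ≥0∞ :=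
  ∫⁻ ω, convergenceTime (N := N) (R := R) (K := K) ζ ω ∂(runLaw N R K p)

end LearningRule

/-! Fix an episode. The agents that may still act in context k form a set A_k, obtained from A_{k-1}
by removing those that succeed in context k-1. The rule acts on the column of strategies of context
k seen only through A_k, and a success is kept for ever, so A_k can only shrink from one episode to
the next. Call min(R, |A_k|) minus the number of successes the holes of the context. If there are no
holes in the first J = min(K, ⌈N/R⌉) contexts, play is frozen and is an efficient equilibrium
(`convergedAt_of_holes`). It remains to show that the expected number of holes decays geometrically
in the number of episodes.

For one context with a fixed set A, `potential` is comparable to the holes and contracts in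
expectation by a factor 1 - ρ (`integral_potential_update_le`). A free resource has value 1, a used
one 0, and a collision of n agents slightly less than 1, with a log n term. Back-offs lower log n or
end in one user or none; the value of a collision is tuned so that the risk of losing all users is
paid by the chance of a success. Free resources are filled by monitoring agents. If nobody yields
this cannot happen, so such gaps carry a small surcharge, which a back-off removes.

The set A is not fixed: new successes in earlier contexts make agents leave, and the potential rises
by at most twice the number of actions thereby abandoned. Given the earlier contexts, active agents
are exchangeable in context k, so the expected number of abandoned actions is at most the
expectation of (leaving agents) · (actions in use) / |A| (`integral_sum_inv_load`). Since |A| is at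
least about (J-1-k)R, each departure costs only O(1/(J-1-k)) there. Moreover, the departures from
context k equal the total decrease of holes in the contexts before k. Weighting context k by about
J-1-k, these costs telescope (`cascade_decay`), so the cascade of disturbances costs only a constant
factor in the rate.

A union bound over contexts gives P(not settled in episode e) ≤ 12 K² min(R,N) (1 - ρ/9)^e, hence an
expected time of order (K/ρ)(1 + log K + log min(R,N)). Choosing ρ (`expectedSteps_le`) and
absorbing log min(R,N) into R or N gives both bounds. -/

namespace AllocationGame

/-! ### Loads, successes and active agents within an episode -/

/-- The strategies of all agents in one context. -/
abbrev Column (N R : ℕ) : Type := Fin N → StageAction R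

variable {N R : ℕ}

/-- The number of agents of `A` whose strategy is `v`. -/
def load (A : Finset (Fin N)) (c : Column N R) (v : StageAction R) : ℕ :=
  (A.filter fun i => c i = v).card

/-- The agents of `A` that access a resource successfully when exactly the agents of `A` follow the
strategies `c`. -/
def winners (A : Finset (Fin N)) (c : Column N R) : Finset (Fin N) :=
  A.filter fun i => c i ≠ none ∧ load A c (c i) = 1

/-- One application of the learning rule to a single context in which the unflagged agents are those
of `A`. -/
def updateColumn (A : Finset (Fin N)) (ξ : Fin N → Bool × Fin R) (c : Column N R) : Column N R :=
  fun i => match c i with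
    | some r => if i ∈ A ∧ 2 ≤ load A c (some r) ∧ (ξ i).1 = true then none else some r
    | none => if load A c (some (ξ i).2) = 0 then some (ξ i).2 else none

/-- The agents without a success in the contexts before `k`, if every context `j` is played
according to `c j`. -/
def active (c : ℕ → Column N R) : ℕ → Finset (Fin N)
  | 0 => Finset.univ
  | k + 1 => active c k \ winners (active c k) (c k)

/-- The joint action when exactly the agents of `A` follow the strategies `c`. -/
def restrictedAction (A : Finset (Fin N)) (c : Column N R) : Fin N → StageAction R :=
  fun i => if i ∈ A then c i else none

theorem load_pos_iff {A : Finset (Fin N)} {c : Column N R} {v : StageAction R} :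
    0 < load A c v ↔ ∃ i ∈ A, c i = v := by
  simp [load, Finset.card_pos, Finset.Nonempty]

theorem load_eq_zero_iff {A : Finset (Fin N)} {c : Column N R} {v : StageAction R} :
    load A c v = 0 ↔ ∀ i ∈ A, c i ≠ v := by
  simp [load, Finset.filter_eq_empty_iff]

theorem two_le_load_iff {A : Finset (Fin N)} {c : Column N R} {v : StageAction R} :
    2 ≤ load A c v ↔ ∃ i ∈ A, ∃ j ∈ A, i ≠ j ∧ c i = v ∧ c j = v := by
  rw [load, ← Nat.lt_iff_add_one_le, Finset.one_lt_card]
  constructor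
  · rintro ⟨i, hi, j, hj, h⟩
    simp only [Finset.mem_filter] at hi hj
    exact ⟨i, hi.1, j, hj.1, h, hi.2, hj.2⟩
  · rintro ⟨i, hi, j, hj, h, h1, h2⟩
    exact ⟨i, by simp [hi, h1], j, by simp [hj, h2], h⟩

theorem load_eq_one_of_mem_winners {A : Finset (Fin N)} {c : Column N R} {i : Fin N}
    (h : i ∈ winners A c) : load A c (c i) = 1 := (Finset.mem_filter.1 h).2.2

theorem eq_of_load_le_one {A : Finset (Fin N)} {c : Column N R} {i j : Fin N} (hi : i ∈ A)
    (hj : j ∈ A) (h : load A c (c i) ≤ 1) (hc : c j = c i) : j = i :=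
  Finset.card_le_one.1 h j (by simp [hj, hc]) i (by simp [hi])

theorem load_mono {A B : Finset (Fin N)} (h : A ⊆ B) (c : Column N R) (v : StageAction R) :
    load A c v ≤ load B c v :=
  Finset.card_le_card (Finset.filter_subset_filter _ h)

theorem winners_subset (A : Finset (Fin N)) (c : Column N R) : winners A c ⊆ A :=
  Finset.filter_subset _ _

theorem isFree_restrictedAction {A : Finset (Fin N)} {c : Column N R} {r : Fin R} :
    IsFree (restrictedAction A c) r ↔ load A c (some r) = 0 := by
  rw [load_eq_zero_iff]
  refine forall_congr' fun i => ?_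
  by_cases h : i ∈ A <;> simp [restrictedAction, h]

theorem collision_restrictedAction {A : Finset (Fin N)} {c : Column N R} {r : Fin R} :
    Collision (restrictedAction A c) r ↔ 2 ≤ load A c (some r) := by
  rw [two_le_load_iff]
  constructor
  · rintro ⟨i, j, hij, hi, hj⟩
    have hiA : i ∈ A := by by_contra h; simp [restrictedAction, h] at hi
    have hjA : j ∈ A := by by_contra h; simp [restrictedAction, h] at hj
    exact ⟨i, hiA, j, hjA, hij, by simpa [restrictedAction, hiA] using hi,
      by simpa [restrictedAction, hjA] using hj⟩
  · rintro ⟨i, hi, j, hj, hij, h1, h2⟩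
    exact ⟨i, j, hij, by simp [restrictedAction, hi, h1], by simp [restrictedAction, hj, h2]⟩

theorem succeeds_restrictedAction {A : Finset (Fin N)} {c : Column N R} {i : Fin N} :
    Succeeds (restrictedAction A c) i ↔ i ∈ winners A c := by
  by_cases hi : i ∈ A
  · simp only [Succeeds, winners, Finset.mem_filter, hi, true_and]
    have hri : restrictedAction A c i = c i := by simp [restrictedAction, hi]
    rw [hri]
    refine and_congr_right fun hne => ?_
    have hpos : 0 < load A c (c i) := load_pos_iff.2 ⟨i, hi, rfl⟩
    constructor
    · intro h
      refine le_antisymm ?_ hpos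
      by_contra hlt
      obtain ⟨a, ha, b, hb, hab, h1, h2⟩ := two_le_load_iff.1 (by omega : 2 ≤ load A c (c i))
      by_cases hai : a = i
      · exact h b (fun hbi => hab (hai.trans hbi.symm)) (by simp [restrictedAction, hb, h2])
      · exact h a hai (by simp [restrictedAction, ha, h1])
    · intro h j hj hEq
      by_cases hjA : j ∈ A
      · simp only [restrictedAction, hjA, if_true] at hEq
        exact hj (eq_of_load_le_one hi hjA h.le hEq)
      · simp only [restrictedAction, hjA, if_false] at hEq
        exact hne hEq.symm
  · have : i ∉ winners A c := fun h => hi (winners_subset A c h)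
    simp [this, Succeeds, restrictedAction, hi]

/-- Under the rule the agents that succeed keep succeeding, so fewer and fewer agents are active. -/
theorem active_subset_of_update {c c' : ℕ → Column N R} {ξ : ℕ → Fin N → Bool × Fin R}
    (h : ∀ k, c' k = updateColumn (active c k) (ξ k) (c k)) (k : ℕ) :
    active c' k ⊆ active c k := by
  induction k with
  | zero => simp [active]
  | succ k ih =>
    intro i hi
    simp only [active, Finset.mem_sdiff] at hi ⊢
    refine ⟨ih hi.1, fun hw => hi.2 ?_⟩
    set A := active c k
    have hiA := winners_subset _ _ hw
    have hload := load_eq_one_of_mem_winners hw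
    obtain ⟨r, hr⟩ := Option.ne_none_iff_exists'.1 (Finset.mem_filter.1 hw).2.1
    have hi' : c' k i = some r := by
      rw [hr] at hload
      simp [h k, updateColumn, hr, A, hload]
    refine Finset.mem_filter.2 ⟨hi.1, by simp [hi'], le_antisymm ?_ ?_⟩
    · refine Finset.card_le_one.2 ?_
      -- Nobody can join a successful agent: yielding agents adopt only free resources, and
      -- accessing agents never switch to another resource.
      have key : ∀ j ∈ (active c' k).filter fun j => c' k j = c' k i, j = i := by
        intro j hj
        simp only [Finset.mem_filter, hi'] at hj
        have hjA : j ∈ A := ih hj.1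
        refine eq_of_load_le_one hiA hjA hload.le ?_
        have hj2 := hj.2
        rw [h k, updateColumn] at hj2
        cases hcj : c k j with
        | none =>
          rw [hcj] at hj2
          simp only at hj2
          split_ifs at hj2 with h0
          rw [Option.some.inj hj2, ← hr] at h0
          change load A (c k) (c k i) = 0 at h0
          omega
        | some r' =>
          rw [hcj] at hj2
          simp only at hj2
          split_ifs at hj2
          rw [hr, hj2]
      intro a ha b hb
      rw [key a ha, key b hb]
    · exact load_pos_iff.2 ⟨i, hi.1, rfl⟩

theorem card_eq_load_none_add_sum (A : Finset (Fin N)) (c : Column N R) :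
    A.card = load A c none + ∑ r, load A c (some r) := by
  rw [Finset.card_eq_sum_card_fiberwise (f := c) (t := Finset.univ) (by simp [Set.MapsTo]),
    Fintype.sum_option]
  rfl

theorem card_winners (A : Finset (Fin N)) (c : Column N R) :
    (winners A c).card = (Finset.univ.filter fun r => load A c (some r) = 1).card := by
  symm
  have h : winners A c = (Finset.univ.filter fun r => load A c (some r) = 1).biUnion
      fun r => A.filter fun i => c i = some r := by
    ext i
    simp only [winners, Finset.mem_filter, Finset.mem_biUnion, Finset.mem_univ, true_and]
    constructor
    · rintro ⟨hi, hne, h1⟩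
      obtain ⟨r, hr⟩ := Option.ne_none_iff_exists'.1 hne
      exact ⟨r, hr ▸ h1, hi, hr⟩
    · rintro ⟨r, h1, hi, hr⟩
      exact ⟨hi, by simp [hr], hr ▸ h1⟩
  rw [h, Finset.card_biUnion]
  · rw [Finset.card_eq_sum_ones]
    exact Finset.sum_congr rfl fun r hr => ((Finset.mem_filter.1 hr).2).symm
  · intro r _ r' _ hrr
    refine Finset.disjoint_left.2 fun i hi hi' => hrr ?_
    simp only [Finset.mem_filter] at hi hi'
    exact Option.some.inj (hi.2.symm.trans hi'.2)

theorem card_winners_le_resources (A : Finset (Fin N)) (c : Column N R) :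
    (winners A c).card ≤ R := by
  rw [card_winners]
  exact (Finset.card_filter_le _ _).trans (by simp)

theorem card_winners_le (A : Finset (Fin N)) (c : Column N R) :
    (winners A c).card ≤ min R A.card :=
  le_min (card_winners_le_resources A c) (Finset.card_le_card (winners_subset A c))

/-! ### Missing successes and settled contexts -/

/-- The number of additional successes that are possible. -/
def holes (A : Finset (Fin N)) (c : Column N R) : ℕ :=
  min R A.card - (winners A c).card

/-- The rule does not change the strategies of the active agents any more. -/
def Settled (A : Finset (Fin N)) (c : Column N R) : Prop :=
  (∀ i ∈ A, i ∈ winners A c) ∨ ∀ r, load A c (some r) = 1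

theorem settled_of_holes_eq_zero {A : Finset (Fin N)} {c : Column N R} (h : holes A c = 0) :
    Settled A c := by
  have hle := card_winners_le A c
  have hw : (winners A c).card = min R A.card := by unfold holes at h; omega
  rcases le_total R A.card with hR | hR
  · right
    rw [min_eq_left hR, card_winners] at hw
    have := Finset.eq_univ_of_card _ (hw.trans (Fintype.card_fin R).symm)
    intro r
    have hr := Finset.mem_univ r
    rw [← this] at hr
    exact (Finset.mem_filter.1 hr).2
  · left
    rw [min_eq_right hR] at hw
    have := Finset.eq_of_subset_of_card_le (winners_subset A c) hw.ge
    intro i hi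
    rwa [this]

theorem Settled.updateColumn_eq {A : Finset (Fin N)} {c : Column N R} (h : Settled A c)
    (ξ : Fin N → Bool × Fin R) {i : Fin N} (hi : i ∈ A) : updateColumn A ξ c i = c i := by
  rcases h with h | h
  · obtain ⟨-, hne, h1⟩ := Finset.mem_filter.1 (h i hi)
    obtain ⟨r, hr⟩ := Option.ne_none_iff_exists'.1 hne
    rw [hr] at h1
    simp [updateColumn, hr, h1]
  · cases hc : c i with
    | none => simp [updateColumn, hc, h]
    | some r => simp [updateColumn, hc, h]

theorem load_congr {A : Finset (Fin N)} {c c' : Column N R} (h : ∀ i ∈ A, c' i = c i)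
    (v : StageAction R) : load A c' v = load A c v := by
  unfold load
  congr 1
  exact Finset.filter_congr fun i hi => by rw [h i hi]

theorem winners_congr {A : Finset (Fin N)} {c c' : Column N R} (h : ∀ i ∈ A, c' i = c i) :
    winners A c' = winners A c :=
  Finset.filter_congr fun i hi => by rw [h i hi, load_congr h]

theorem Settled.congr {A : Finset (Fin N)} {c c' : Column N R} (h : ∀ i ∈ A, c' i = c i)
    (hs : Settled A c) : Settled A c' := by
  unfold Settled at hs ⊢
  rw [winners_congr h]
  simpa only [load_congr h] using hs

theorem active_eq_of_settled {c c' : ℕ → Column N R} {ξ : ℕ → Fin N → Bool × Fin R} {K : ℕ}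
    (h : ∀ k, c' k = updateColumn (active c k) (ξ k) (c k))
    (hs : ∀ k < K, Settled (active c k) (c k)) {k : ℕ} (hk : k ≤ K) :
    active c' k = active c k := by
  induction k with
  | zero => rfl
  | succ k ih =>
    rw [active, active, ih (by omega), winners_congr]
    intro i hi
    rw [h k, (hs k (by omega)).updateColumn_eq _ hi]

theorem card_active_succ (c : ℕ → Column N R) (k : ℕ) :
    (active c (k + 1)).card + (winners (active c k) (c k)).card = (active c k).card := by
  rw [active, Finset.card_sdiff_add_card_eq_card (winners_subset _ _)]

theorem card_active_ge (c : ℕ → Column N R) (k : ℕ) : N ≤ (active c k).card + k * R := by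
  induction k with
  | zero => simp [active]
  | succ k ih =>
    have h1 := card_active_succ c k
    have h2 := card_winners_le_resources (active c k) (c k)
    rw [Nat.succ_mul]
    omega

theorem card_active_of_holes_eq_zero {c : ℕ → Column N R} {J : ℕ}
    (h : ∀ k < J, holes (active c k) (c k) = 0) {k : ℕ} (hk : k ≤ J) :
    (active c k).card = N - k * R := by
  induction k with
  | zero => simp [active]
  | succ k ih =>
    have h1 := card_active_succ c k
    have h2 := card_winners_le (active c k) (c k)
    have h3 := h k (by omega)
    have h4 := ih (by omega)
    unfold holes at h3
    rw [Nat.succ_mul]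
    omega

/-- The number of contexts that are needed to serve all agents, or all contexts if they do not
suffice. -/
noncomputable def servedContexts (N R K : ℕ) : ℕ := min K ⌈(N : ℝ) / R⌉₊

/-- Either all contexts are covered by the hypothesis, or the first ⌈N/R⌉ contexts, being full, have
served everybody and every later active set is empty. So only the first `servedContexts` contexts
enter the probabilistic estimates. -/
theorem settled_of_holes {c : ℕ → Column N R} {K : ℕ} (hR : 0 < R)
    (h : ∀ k < servedContexts N R K, holes (active c k) (c k) = 0) :
    ∀ k < K, Settled (active c k) (c k) := by
  intro k hk
  by_cases hJ : k < servedContexts N R K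
  · exact settled_of_holes_eq_zero (h k hJ)
  · have hle : ⌈(N : ℝ) / R⌉₊ ≤ k := by unfold servedContexts at hJ; omega
    have hJ' : servedContexts N R K = ⌈(N : ℝ) / R⌉₊ := by unfold servedContexts; omega
    have hcard := card_active_of_holes_eq_zero h le_rfl
    have hN : N ≤ servedContexts N R K * R := by
      rw [hJ']
      have := Nat.le_ceil ((N : ℝ) / R)
      rw [div_le_iff₀ (by exact_mod_cast hR)] at this
      exact_mod_cast this
    have hempty : active c (servedContexts N R K) = ∅ := by
      rw [← Finset.card_eq_zero]; omega
    have hmono : ∀ m, active c (servedContexts N R K + m) = ∅ := by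
      intro m
      induction m with
      | zero => exact hempty
      | succ m ih => rw [← add_assoc, active, ih]; simp
    obtain ⟨m, rfl⟩ := Nat.exists_eq_add_of_le (hJ'.trans_le hle)
    left
    simp [hmono m]

theorem jointAction_eq {K : ℕ} {s : AgentState N R K} {A : Finset (Fin N)} {k : Fin K}
    {c : Column N R} (hc : ∀ n, s.g n k = c n) (hA : ∀ n, s.accessed n = decide (n ∉ A)) :
    s.jointAction k = restrictedAction A c := by
  funext n
  by_cases h : n ∈ A <;> simp [AgentState.jointAction, restrictedAction, hc, hA, h]

/-! ### From time-steps to episodes -/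

section Run

variable {K : ℕ} [NeZero K]

/-- The strategies for all contexts at the beginning of an episode. (The columns with index at
least `K` have no meaning.) -/
def runColumns (ω : Randomness N R K) : ℕ → ℕ → Column N R
  | 0 => fun k n => ω.1 n (Fin.ofNat K k)
  | e + 1 => fun k => updateColumn (active (runColumns ω e) k) (ω.2 (e * K + k)) (runColumns ω e k)

theorem contextAt_val {e k : ℕ} (hk : k < K) : ((contextAt K (e * K + k) : Fin K) : ℕ) = k := by
  simp [contextAt, Fin.ofNat, Nat.mod_eq_of_lt hk]

/-- Translates the time-step dynamics into `runColumns`: within episode e the contexts before k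
already carry the strategies for episode e + 1, the others still those for e. -/
theorem stateAt_eq (ω : Randomness N R K) (e k : ℕ) (hk : k < K) :
    (∀ n (j : Fin K), (stateAt ω (e * K + k)).g n j =
      runColumns ω (if (j : ℕ) < k then e + 1 else e) j n) ∧
    ∀ n, (stateAt ω (e * K + k)).accessed n = decide (n ∉ active (runColumns ω e) k) := by
  -- A single time-step. The flags come out as False after the last context, so the two inductions
  -- below can pass through the boundary between episodes.
  have key : ∀ e k : ℕ, k < K →
      ((∀ n (j : Fin K), (stateAt ω (e * K + k)).g n j =
        runColumns ω (if (j : ℕ) < k then e + 1 else e) j n) ∧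
      ∀ n, (stateAt ω (e * K + k)).accessed n = decide (n ∉ active (runColumns ω e) k)) →
      (∀ n (j : Fin K), (stateAt ω (e * K + k + 1)).g n j =
        runColumns ω (if (j : ℕ) < k + 1 then e + 1 else e) j n) ∧
      ∀ n, (stateAt ω (e * K + k + 1)).accessed n =
        if k + 1 = K then false else decide (n ∉ active (runColumns ω e) (k + 1)) := by
    intro e k hk ⟨hg, ha⟩
    have hctx : contextAt K (e * K + k) = ⟨k, hk⟩ := Fin.ext (contextAt_val hk)
    have hgk : ∀ n, (stateAt ω (e * K + k)).g n ⟨k, hk⟩ = runColumns ω e k n := by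
      intro n; simp [hg]
    have hjoint := jointAction_eq hgk ha
    constructor
    · intro n j
      rw [stateAt, hctx]
      simp only [AgentState.step, hjoint]
      by_cases hj : j = ⟨k, hk⟩
      · subst hj
        simp only [Function.update_self, hgk, lt_add_iff_pos_right, zero_lt_one, if_true]
        simp only [runColumns, updateColumn]
        cases runColumns ω e k n <;>
          simp [hjoint, isFree_restrictedAction, collision_restrictedAction, ha]
      · have hjk : (j : ℕ) ≠ k := fun h => hj (Fin.ext h)
        rw [Function.update_of_ne hj, hg]
        simp only [show ((j : ℕ) < k + 1) = ((j : ℕ) < k) from by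
          simp only [eq_iff_iff]; omega]
    · intro n
      rw [stateAt, hctx]
      simp only [AgentState.step, hjoint, ha, succeeds_restrictedAction]
      split_ifs
      · rfl
      · by_cases h : n ∈ active (runColumns ω e) k <;> simp [active, Finset.mem_sdiff, h]
  induction e generalizing k with
  | zero =>
    induction k with
    | zero =>
      refine ⟨fun n j => ?_, fun n => by simp [stateAt, active]⟩
      simp only [Nat.zero_mul, Nat.add_zero, stateAt, Nat.not_lt_zero, if_false, runColumns]
      rw [show Fin.ofNat K j = j from Fin.ext (Nat.mod_eq_of_lt j.2)]
    | succ k ih =>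
      obtain ⟨h1, h2⟩ := key 0 k (by omega) (ih (by omega))
      exact ⟨h1, fun n => by rw [← add_assoc, h2, if_neg (by omega)]⟩
  | succ e ihe =>
    induction k with
    | zero =>
      have hK : 0 < K := by omega
      obtain ⟨h1, h2⟩ := key e (K - 1) (by omega) (ihe (K - 1) (by omega))
      have hadd : e * K + (K - 1) + 1 = (e + 1) * K + 0 := by rw [Nat.succ_mul]; omega
      rw [hadd] at h1 h2
      refine ⟨fun n j => ?_, fun n => ?_⟩
      · rw [h1, if_pos (by omega), if_neg (by omega)]
      · rw [h2, if_pos (by omega)]; simp [active]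
    | succ k ih =>
      obtain ⟨h1, h2⟩ := key (e + 1) k (by omega) (ih (by omega))
      exact ⟨h1, fun n => by rw [← add_assoc, h2, if_neg (by omega)]⟩

theorem actionAt_eq (ω : Randomness N R K) {e k : ℕ} (hk : k < K) :
    actionAt ω (e * K + k) = restrictedAction (active (runColumns ω e) k) (runColumns ω e k) := by
  obtain ⟨h1, h2⟩ := stateAt_eq ω e k hk
  refine jointAction_eq (fun n => ?_) h2
  rw [h1, contextAt_val hk, if_neg (lt_irrefl k)]

theorem actionAt_eq_of_settled (ω : Randomness N R K) {e : ℕ}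
    (hs : ∀ k < K, Settled (active (runColumns ω e) k) (runColumns ω e k)) {t : ℕ}
    (ht : e * K ≤ t) :
    actionAt ω t = restrictedAction (active (runColumns ω e) (contextAt K t))
      (runColumns ω e (contextAt K t)) := by
  have hK : 0 < K := Nat.pos_of_ne_zero (NeZero.ne K)
  -- Invariance is claimed for active agents only: an agent with its flag set whose strategy is to
  -- yield still monitors, and may change its strategy without any effect on play.
  have key : ∀ m, ∀ k < K, Settled (active (runColumns ω (e + m)) k) (runColumns ω (e + m) k) ∧
      active (runColumns ω (e + m)) k = active (runColumns ω e) k ∧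
      ∀ i ∈ active (runColumns ω e) k, runColumns ω (e + m) k i = runColumns ω e k i := by
    intro m
    induction m with
    | zero => exact fun k hk => ⟨hs k hk, rfl, fun _ _ => rfl⟩
    | succ m ih =>
      intro k hk
      have hA := active_eq_of_settled (c := runColumns ω (e + m)) (c' := runColumns ω (e + m + 1))
        (ξ := fun k => ω.2 ((e + m) * K + k)) (fun k => rfl) (fun k hk => (ih k hk).1) hk.le
      have hc : ∀ i ∈ active (runColumns ω (e + m)) k,
          runColumns ω (e + m + 1) k i = runColumns ω (e + m) k i :=
        fun i hi => (ih k hk).1.updateColumn_eq _ hi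
      rw [← add_assoc]
      refine ⟨?_, hA.trans (ih k hk).2.1, fun i hi => ?_⟩
      · rw [hA]; exact (ih k hk).1.congr hc
      · rw [hc i (by rwa [(ih k hk).2.1]), (ih k hk).2.2 i hi]
  have hlt := Nat.mod_lt t hK
  have hdiv : e ≤ t / K := (Nat.le_div_iff_mul_le hK).2 ht
  obtain ⟨m, hm⟩ := Nat.exists_eq_add_of_le hdiv
  have hctx : ((contextAt K t : Fin K) : ℕ) = t % K := by simp [contextAt, Fin.ofNat]
  have ht' : t = (e + m) * K + t % K := by
    rw [← hm, mul_comm]; exact (Nat.div_add_mod t K).symm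
  rw [hctx]
  conv_lhs => rw [ht']
  rw [actionAt_eq ω hlt, (key m _ hlt).2.1]
  funext i
  by_cases hi : i ∈ active (runColumns ω e) (t % K)
  · simp [restrictedAction, hi, (key m _ hlt).2.2 i hi]
  · simp [restrictedAction, hi]

end Run

end AllocationGame

/-! ### Settled columns are efficient equilibria -/

namespace AllocationGame

variable {N R K : ℕ}

open Classical in
theorem payoff_le_indicator {ζ : ℝ} (hζ : ζ < 0) (a : Fin N → StageAction R) (n : Fin N) :
    payoff ζ a n ≤ if Succeeds a n then 1 else 0 := by
  unfold payoff Succeeds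
  by_cases h1 : a n = none
  · simp [h1]
  · by_cases h2 : ∀ i, i ≠ n → a i ≠ a n
    · rw [if_neg h1, if_pos h2, if_pos ⟨h1, h2⟩]
    · rw [if_neg h1, if_neg h2, if_neg (fun h => h2 h.2)]
      exact hζ.le

theorem payoff_of_succeeds {ζ : ℝ} {a : Fin N → StageAction R} {n : Fin N} (h : Succeeds a n) :
    payoff ζ a n = 1 := by
  rw [payoff, if_neg h.1, if_pos h.2]

theorem payoff_le_one {ζ : ℝ} (hζ : ζ < 0) (a : Fin N → StageAction R) (n : Fin N) :
    payoff ζ a n ≤ 1 := by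
  classical
  refine (payoff_le_indicator hζ a n).trans ?_
  split_ifs <;> norm_num

/-- Under the quota at most one success is possible, and only successes have positive payoff. -/
theorem sum_payoff_le_one_of_respectsQuota {ζ : ℝ} (hζ : ζ < 0) {σ : Plan N R K} {n : Fin N}
    (h : RespectsQuota σ n) : ∑ k, payoff ζ (σ k) n ≤ 1 := by
  classical
  refine (Finset.sum_le_sum fun k _ => payoff_le_indicator hζ (σ k) n).trans ?_
  rw [Finset.sum_boole]
  norm_cast
  refine Finset.card_le_one.2 fun j hj k hk => ?_
  simp only [Finset.mem_filter, Finset.mem_univ, true_and] at hj hk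
  by_contra hjk
  rcases lt_or_gt_of_ne hjk with hlt | hlt
  · exact h k hk.1 j hlt hj
  · exact h j hj.1 k hlt hk

theorem sum_agents_payoff_le {ζ : ℝ} (hζ : ζ < 0) (a : Fin N → StageAction R) :
    ∑ n, payoff ζ a n ≤ R := by
  classical
  refine (Finset.sum_le_sum fun n _ => payoff_le_indicator hζ a n).trans ?_
  rw [Finset.sum_boole]
  norm_cast
  have hle : (Finset.univ.filter fun n => Succeeds a n).card ≤
      ((Finset.univ : Finset (Fin R)).image some).card := by
    refine Finset.card_le_card_of_injOn a ?_ ?_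
    · intro n hn
      simp only [Finset.coe_filter, Finset.mem_univ, true_and, Set.mem_ofPred_eq] at hn
      obtain ⟨r, hr⟩ := Option.ne_none_iff_exists'.1 hn.1
      simp [hr]
    · intro n hn m hm hnm
      simp only [Finset.coe_filter, Finset.mem_univ, true_and, Set.mem_ofPred_eq] at hn hm
      by_contra hne
      exact hm.2 n hne hnm
  exact hle.trans (Finset.card_image_le.trans (by simp))

/-- The plan in which every context is played according to `c`, under the quota. -/
def quotaPlan (K : ℕ) (c : ℕ → Column N R) : Plan N R K :=
  fun k => restrictedAction (active c k) (c k)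

theorem mem_active_iff {c : ℕ → Column N R} {k : ℕ} {n : Fin N} :
    n ∈ active c k ↔ ∀ j < k, n ∉ winners (active c j) (c j) := by
  induction k with
  | zero => simp [active]
  | succ k ih =>
    rw [active, Finset.mem_sdiff, ih]
    constructor
    · rintro ⟨h1, h2⟩ j hj
      rcases Nat.lt_succ_iff_lt_or_eq.1 hj with h | rfl
      · exact h1 j h
      · exact h2
    · exact fun h => ⟨fun j hj => h j (by omega), h k (by omega)⟩

theorem eligible_quotaPlan {c : ℕ → Column N R} {k : Fin K} {n : Fin N} :
    Eligible (quotaPlan K c) k n ↔ n ∈ active c k := by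
  rw [mem_active_iff]
  constructor
  · intro h j hj
    have := h ⟨j, hj.trans k.2⟩ hj
    rwa [quotaPlan, succeeds_restrictedAction] at this
  · intro h j hj
    rw [quotaPlan, succeeds_restrictedAction]
    exact h j hj

theorem respectsQuota_quotaPlan (c : ℕ → Column N R) (n : Fin N) :
    RespectsQuota (quotaPlan K c) n := by
  intro k hk
  rw [eligible_quotaPlan]
  by_contra h
  exact hk (by simp [quotaPlan, restrictedAction, h])

theorem Settled.payoff_nonneg {A : Finset (Fin N)} {c : Column N R} (h : Settled A c) (ζ : ℝ)
    (n : Fin N) : 0 ≤ payoff ζ (restrictedAction A c) n := by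
  by_cases hn : restrictedAction A c n = none
  · simp [payoff, hn]
  · have hnA : n ∈ A := by
      by_contra hnA
      exact hn (by simp [restrictedAction, hnA])
    have hw : n ∈ winners A c := by
      rcases h with h | h
      · exact h n hnA
      · simp only [restrictedAction, hnA, if_true] at hn
        refine Finset.mem_filter.2 ⟨hnA, hn, ?_⟩
        obtain ⟨r, hr⟩ := Option.ne_none_iff_exists'.1 hn
        rw [hr]
        exact h r
    rw [payoff_of_succeeds (succeeds_restrictedAction.2 hw)]
    norm_num

/-- An active agent without a success cannot gain, because every resource is in use. -/
theorem Settled.payoff_update_nonpos {A : Finset (Fin N)} {c : Column N R} (h : Settled A c)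
    {ζ : ℝ} (hζ : ζ < 0) {n : Fin N} (hn : n ∈ A) (hw : n ∉ winners A c) (b : StageAction R) :
    payoff ζ (Function.update (restrictedAction A c) n b) n ≤ 0 := by
  have hload : ∀ r, load A c (some r) = 1 := by
    rcases h with h | h
    · exact absurd (h n hn) hw
    · exact h
  classical
  refine (payoff_le_indicator hζ _ n).trans ?_
  rw [if_neg]
  rintro ⟨h1, h2⟩
  rw [Function.update_self] at h1 h2
  obtain ⟨r, rfl⟩ := Option.ne_none_iff_exists'.1 h1
  obtain ⟨i, hi, hir⟩ := load_pos_iff.1 (by rw [hload r]; norm_num : 0 < load A c (some r))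
  have hin : i ≠ n := by
    rintro rfl
    exact hw (Finset.mem_filter.2 ⟨hi, by simp [hir], by rw [hir]; exact hload r⟩)
  refine h2 i hin ?_
  rw [Function.update_of_ne hin]
  simp [restrictedAction, hi, hir]

/-- An agent that succeeds somewhere already has the maximal total 1. An agent that never succeeds
is active everywhere, so every resource is occupied by others in every context and no deviation
earns anything positive. -/
theorem isEfficientEquilibrium_quotaPlan [NeZero R] {ζ : ℝ} (hζ : ζ < 0) {c : ℕ → Column N R}
    (hs : ∀ k < K, Settled (active c k) (c k)) :
    IsEfficientEquilibrium ζ (quotaPlan K c) := by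
  have hpay : ∀ (k : Fin K) n, 0 ≤ payoff ζ (quotaPlan K c k) n :=
    fun k n => (hs k k.2).payoff_nonneg ζ n
  have hone : ∀ n, (∃ k : Fin K, n ∈ winners (active c k) (c k)) →
      1 ≤ ∑ k, payoff ζ (quotaPlan K c k) n := by
    rintro n ⟨k, hk⟩
    rw [← payoff_of_succeeds (ζ := ζ) (succeeds_restrictedAction.2 hk)]
    exact Finset.single_le_sum (f := fun k => payoff ζ (quotaPlan K c k) n)
      (fun k _ => hpay k n) (Finset.mem_univ k)
  refine ⟨⟨respectsQuota_quotaPlan c, fun n d hd => ?_⟩, fun k n hk b => ?_, fun σ' hσ' => ?_⟩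
  · by_cases hn : ∃ k : Fin K, n ∈ winners (active c k) (c k)
    · exact (sum_payoff_le_one_of_respectsQuota hζ hd).trans (hone n hn)
    · push Not at hn
      refine (Finset.sum_nonpos fun k _ => ?_).trans (Finset.sum_nonneg fun k _ => hpay k n)
      exact (hs k k.2).payoff_update_nonpos hζ
        (mem_active_iff.2 fun j hj => hn ⟨j, hj.trans k.2⟩) (hn k) _
  · rw [eligible_quotaPlan] at hk
    by_cases hw : n ∈ winners (active c k) (c k)
    · refine (payoff_le_one hζ _ n).trans_eq ?_
      exact (payoff_of_succeeds (succeeds_restrictedAction.2 hw)).symm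
    · exact ((hs k k.2).payoff_update_nonpos hζ hk hw b).trans (hpay k n)
  -- Two ways of being optimal: every context attains its upper bound R, or some context serves all
  -- agents still active, and then every agent attains its upper bound 1.
  · by_cases hall : ∀ k : Fin K, ∀ r, load (active c k) (c k) (some r) = 1
    · refine Finset.sum_le_sum fun k _ => (sum_agents_payoff_le hζ _).trans ?_
      have hcard : (winners (active c k) (c k)).card = R := by
        rw [card_winners, Finset.filter_true_of_mem fun r _ => hall k r]
        simp
      calc (R : ℝ) = ∑ n ∈ winners (active c k) (c k), payoff ζ (quotaPlan K c k) n := by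
            have h1 : ∀ n ∈ winners (active c k) (c k), payoff ζ (quotaPlan K c k) n = 1 :=
              fun n hn => payoff_of_succeeds (succeeds_restrictedAction.2 hn)
            simp [Finset.sum_congr rfl h1, hcard]
        _ ≤ _ := Finset.sum_le_sum_of_subset_of_nonneg (Finset.subset_univ _)
            fun n _ _ => hpay k n
    · push Not at hall
      obtain ⟨k, r, hr⟩ := hall
      have hk : ∀ i ∈ active c k, i ∈ winners (active c k) (c k) := by
        rcases hs k k.2 with h | h
        · exact h
        · exact absurd (h r) hr
      rw [Finset.sum_comm, Finset.sum_comm (s := Finset.univ (α := Fin K))]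
      refine Finset.sum_le_sum fun n _ =>
        (sum_payoff_le_one_of_respectsQuota hζ (hσ' n)).trans (hone n ?_)
      by_cases hn : n ∈ active c k
      · exact ⟨k, hk n hn⟩
      · rw [mem_active_iff] at hn
        push Not at hn
        obtain ⟨j, hj, hjn⟩ := hn
        exact ⟨⟨j, hj.trans k.2⟩, hjn⟩

theorem convergedAt_of_holes [NeZero R] [NeZero K] {ζ : ℝ} (hζ : ζ < 0) {ω : Randomness N R K}
    {e : ℕ} (h : ∀ k < servedContexts N R K,
      holes (active (runColumns ω e) k) (runColumns ω e k) = 0) :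
    ConvergedAt ζ ω (e * K) := by
  have hs := settled_of_holes (Nat.pos_of_ne_zero (NeZero.ne R)) h
  exact ⟨_, isEfficientEquilibrium_quotaPlan hζ hs, fun t ht => actionAt_eq_of_settled ω hs ht⟩

theorem convergenceTime_le_of_holes [NeZero R] [NeZero K] {ζ : ℝ} (hζ : ζ < 0)
    {ω : Randomness N R K} {e : ℕ} (h : ∀ k < servedContexts N R K,
      holes (active (runColumns ω e) k) (runColumns ω e k) = 0) :
    convergenceTime ζ ω ≤ (e * K : ℕ) :=
  iInf₂_le (e * K) (convergedAt_of_holes hζ h)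

end AllocationGame

/-! ### The coins of one time-step -/

namespace AllocationGame

variable {N R : ℕ}

section Coins

/-- The law of the random choices of all agents in one time-step. -/
noncomputable def coinLaw (N R : ℕ) [NeZero R] (p : unitInterval) :
    Measure (Fin N → Bool × Fin R) :=
  Measure.pi fun _ : Fin N =>
    (bernoulliMeasure true false p).prod (PMF.uniformOfFintype (Fin R)).toMeasure

variable [NeZero R] (p : unitInterval)

instance : IsProbabilityMeasure (coinLaw N R p) := by
  unfold coinLaw; infer_instance

theorem integral_coinLaw_prod (S : Finset (Fin N)) (f : Fin N → Bool × Fin R → ℝ) :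
    ∫ ξ, ∏ i ∈ S, f i (ξ i) ∂(coinLaw N R p) =
      ∏ i ∈ S, ∫ x, f i x
        ∂((bernoulliMeasure true false p).prod (PMF.uniformOfFintype (Fin R)).toMeasure) := by
  have h := integral_fintype_prod_eq_prod (𝕜 := ℝ) (fun i x => if i ∈ S then f i x else 1)
    (μ := fun _ : Fin N =>
      (bernoulliMeasure true false p).prod (PMF.uniformOfFintype (Fin R)).toMeasure)
  simp only [Finset.prod_ite_mem, Finset.univ_inter] at h
  rw [coinLaw, h, ← Finset.prod_subset (Finset.subset_univ S)]
  · exact Finset.prod_congr rfl fun i hi => by simp [hi]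
  · intro i _ hi
    simp [hi]

theorem integral_backoff (f : Bool → ℝ) :
    ∫ x : Bool × Fin R, f x.1
      ∂((bernoulliMeasure true false p).prod (PMF.uniformOfFintype (Fin R)).toMeasure) =
      p * f true + (1 - p) * f false := by
  rw [integral_fun_fst, integral_bernoulliMeasure]
  simp

theorem integral_monitor (f : Fin R → ℝ) :
    ∫ x : Bool × Fin R, f x.2
      ∂((bernoulliMeasure true false p).prod (PMF.uniformOfFintype (Fin R)).toMeasure) =
      (∑ r, f r) / R := by
  rw [integral_fun_snd, PMF.integral_eq_sum]
  simp [div_eq_inv_mul, Finset.mul_sum]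

theorem integral_coinLaw_apply (i : Fin N) (f : Bool × Fin R → ℝ) :
    ∫ ξ, f (ξ i) ∂(coinLaw N R p) =
      ∫ x, f x
        ∂((bernoulliMeasure true false p).prod (PMF.uniformOfFintype (Fin R)).toMeasure) := by
  simpa using integral_coinLaw_prod p {i} fun _ => f

theorem integral_backoff_apply (i : Fin N) (f : Bool → ℝ) :
    ∫ ξ, f (ξ i).1 ∂(coinLaw N R p) = p * f true + (1 - p) * f false := by
  rw [integral_coinLaw_apply p i (fun x => f x.1), integral_backoff]

theorem integral_monitor_apply (i : Fin N) (r : Fin R) :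
    ∫ ξ, (if (ξ i).2 = r then 1 else 0 : ℝ) ∂(coinLaw N R p) = 1 / R := by
  rw [integral_coinLaw_apply p i (fun x => if x.2 = r then 1 else 0),
    integral_monitor p (fun s => if s = r then 1 else 0)]
  simp

end Coins

/-! ### The value of a contested resource and its decay -/

/-- The value of a resource with `n` users in the potential function: it is `0` for a successful
access, and below the value `1` of a free resource for a collision. -/
noncomputable def contestValue (α L : ℝ) (n : ℕ) : ℝ :=
  if n = 0 then 1 else if n = 1 then 0 else 1 - α / 2 + α / 4 * (Real.log n / L)

@[simp] theorem contestValue_zero (α L : ℝ) : contestValue α L 0 = 1 := rfl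

@[simp] theorem contestValue_one (α L : ℝ) : contestValue α L 1 = 0 := rfl

theorem contestValue_of_two_le (α L : ℝ) {n : ℕ} (h : 2 ≤ n) :
    contestValue α L n = 1 - α / 2 + α / 4 * (Real.log n / L) := by
  rw [contestValue, if_neg (by omega), if_neg (by omega)]

/-- The margin α/4 below the value of a free resource is the gain when a free resource is taken,
even if several agents rush to it at once and collide. -/
theorem contestValue_le {α : ℝ} (h0 : 0 ≤ α) (h1 : α ≤ 1) {n : ℕ} (hn : n ≠ 0) (hnN : n ≤ N) :
    contestValue α (Real.log N) n ≤ 1 - α / 4 := by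
  rcases (by omega : n = 1 ∨ 2 ≤ n) with rfl | h
  · simp; linarith
  · rw [contestValue_of_two_le _ _ h]
    have hlog : Real.log n / Real.log N ≤ 1 := by
      refine div_le_one_of_le₀ ?_ (Real.log_natCast_nonneg N)
      exact Real.log_le_log (by positivity) (by exact_mod_cast hnN)
    nlinarith

theorem contestValue_le_one {α : ℝ} (h0 : 0 ≤ α) (h1 : α ≤ 1) {n : ℕ} (hnN : n ≤ N) :
    contestValue α (Real.log N) n ≤ 1 := by
  by_cases h : n = 0
  · simp [h]
  · linarith [contestValue_le h0 h1 h hnN]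

theorem half_le_contestValue {α : ℝ} (h0 : 0 ≤ α) (h1 : α ≤ 1) {n : ℕ} (hn : 2 ≤ n) :
    1 / 2 ≤ contestValue α (Real.log N) n := by
  rw [contestValue_of_two_le _ _ hn]
  have : 0 ≤ α / 4 * (Real.log n / Real.log N) :=
    mul_nonneg (by linarith) (div_nonneg (Real.log_natCast_nonneg n) (Real.log_natCast_nonneg N))
  linarith

theorem contestValue_mono {α : ℝ} (h0 : 0 ≤ α) {m n : ℕ} (hm : 2 ≤ m) (hmn : m ≤ n) :
    contestValue α (Real.log N) m ≤ contestValue α (Real.log N) n := by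
  rw [contestValue_of_two_le _ _ hm, contestValue_of_two_le _ _ (hm.trans hmn)]
  have hlog : Real.log m ≤ Real.log n :=
    Real.log_le_log (by positivity) (by exact_mod_cast hmn)
  have := Real.log_natCast_nonneg N
  gcongr

theorem contestValue_nonneg {α : ℝ} (h0 : 0 ≤ α) (h1 : α ≤ 1) (n : ℕ) :
    0 ≤ contestValue α (Real.log N) n := by
  rcases (by omega : n = 0 ∨ n = 1 ∨ 2 ≤ n) with rfl | rfl | h
  · simp
  · simp
  · linarith [half_le_contestValue (N := N) h0 h1 h]

/-- From log x ≥ 1 - 1/x applied to n/b. The right side is affine in b apart from the indicators of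
b = 0 and b = 1, so its expectation over the survivors b of a collision of n agents needs only their
mean and two probabilities. -/
theorem contestValue_le_linear {α : ℝ} (h0 : 0 ≤ α) {n b : ℕ} (hn : 2 ≤ n)
    (hnN : n ≤ N) (hb : b ≤ n) :
    contestValue α (Real.log N) b ≤ contestValue α (Real.log N) n -
      α / (4 * Real.log N) * (1 - b / n) + 5 / 8 * α * (if b = 0 then 1 else 0) -
      (1 - α / 2) * (if b = 1 then 1 else 0) := by
  have hn0 : (0 : ℝ) < n := by positivity
  have hlog2 : Real.log 2 ≤ Real.log n :=
    Real.log_le_log (by norm_num) (by exact_mod_cast hn)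
  have hL : Real.log 2 ≤ Real.log N :=
    Real.log_le_log (by norm_num) (by exact_mod_cast hn.trans hnN)
  have h2 := Real.log_two_gt_d9
  have hLpos : 0 < Real.log N := by linarith
  have hα : α / 4 * (Real.log n / Real.log N) = α / (4 * Real.log N) * Real.log n := by
    field_simp
  have hq : 0 ≤ α / (4 * Real.log N) := by positivity
  rw [contestValue_of_two_le _ _ hn, hα]
  rcases (by omega : b = 0 ∨ b = 1 ∨ 2 ≤ b) with rfl | rfl | h
  · have h3 : α / (4 * Real.log N) * (1 - Real.log n) ≤ α / (4 * Real.log N) * (1 / 2 * Real.log N) :=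
      mul_le_mul_of_nonneg_left (by linarith) hq
    have h4 : α / (4 * Real.log N) * (1 / 2 * Real.log N) = α / 8 := by field_simp; ring
    simp
    linarith
  · have h3 : 1 - 1 / (n : ℝ) ≤ Real.log n := by
      have := Real.one_sub_inv_le_log_of_pos hn0
      simpa using this
    have h4 := mul_le_mul_of_nonneg_left h3 hq
    simp at h4 ⊢
    linarith
  · rw [contestValue_of_two_le _ _ h, if_neg (by omega), if_neg (by omega)]
    have hb0 : (0 : ℝ) < b := by positivity
    have h3 : 1 - (b : ℝ) / n ≤ Real.log n - Real.log b := by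
      have := Real.one_sub_inv_le_log_of_pos (div_pos hn0 hb0)
      rwa [inv_div, Real.log_div hn0.ne' hb0.ne'] at this
    have h4 := mul_le_mul_of_nonneg_left h3 hq
    have hα' : α / 4 * (Real.log b / Real.log N) = α / (4 * Real.log N) * Real.log b := by
      field_simp
    rw [hα']
    linarith

/-- A lower bound for the probability that a collision ends with a success. -/
noncomputable def successRate (p : ℝ) : ℝ := 2 * (1 - p) / (2 - p)

theorem successRate_pos {p : ℝ} (h : p < 1) : 0 < successRate p :=
  div_pos (by linarith) (by linarith)

theorem successRate_le_one {p : ℝ} (h0 : 0 ≤ p) (h : p < 1) : successRate p ≤ 1 := by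
  rw [successRate, div_le_one (by linarith)]; linarith

/-- The log term falls by the relative loss of users, which is p on average. The danger that all n
agents back off, with probability p^n, is outweighed by the chance that exactly one remains, which
is at least 2(1-p)p^(n-1). -/
theorem integral_contestValue_survivors_le [NeZero R] {p : unitInterval} (hp0 : 0 < (p : ℝ))
    (hp1 : (p : ℝ) < 1) (S : Finset (Fin N)) (hS : 2 ≤ S.card) :
    ∫ ξ, contestValue (successRate p) (Real.log N) (S.filter fun i => (ξ i).1 = false).card
      ∂(coinLaw N R p) ≤
      contestValue (successRate p) (Real.log N) S.card -
        successRate p * p / (4 * Real.log N) := by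
  set α := successRate p with hα
  have hα0 : 0 ≤ α := (successRate_pos hp1).le
  set L := Real.log N
  set n := S.card with hn
  have hSN : n ≤ N := by simpa using Finset.card_le_univ S
  obtain ⟨a, ha, b, hb, hab⟩ := Finset.one_lt_card.1 hS
  let T : (Fin N → Bool × Fin R) → ℝ := fun ξ =>
    ∏ i ∈ S, if (ξ i).1 = true then 1 else 0
  -- The event that this agent alone does not back off. Two agents a and b suffice: their events are
  -- disjoint and the bound is needed only as for a collision of two.
  let E : Fin N → (Fin N → Bool × Fin R) → ℝ := fun a ξ =>
    ∏ i ∈ S, if (ξ i).1 = decide (i ≠ a) then 1 else 0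
  have hT : ∀ ξ, T ξ = if (S.filter fun i => (ξ i).1 = false).card = 0 then 1 else 0 := by
    intro ξ
    simp only [T]
    rw [Finset.prod_ite_zero]
    simp [Finset.filter_eq_empty_iff]
  have hE1 : ∀ ξ, E a ξ + E b ξ ≤
      if (S.filter fun i => (ξ i).1 = false).card = 1 then 1 else 0 := by
    intro ξ
    have hone : ∀ x ∈ S, (∀ i ∈ S, (ξ i).1 = decide (i ≠ x)) →
        (S.filter fun i => (ξ i).1 = false) = {x} := by
      intro x hx h
      ext i
      simp only [Finset.mem_filter, Finset.mem_singleton]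
      constructor
      · rintro ⟨hi, h2⟩
        rw [h i hi] at h2
        simpa using h2
      · rintro rfl
        exact ⟨hx, by simp [h i hx]⟩
    simp only [E, Finset.prod_ite_zero, Finset.prod_const_one]
    by_cases h1 : ∀ i ∈ S, (ξ i).1 = decide (i ≠ a)
    · have h2 : ¬ ∀ i ∈ S, (ξ i).1 = decide (i ≠ b) := by
        intro h2
        have := (hone a ha h1).symm.trans (hone b hb h2)
        exact hab (Finset.singleton_injective this)
      rw [if_pos h1, if_neg h2, hone a ha h1]
      simp
    · by_cases h2 : ∀ i ∈ S, (ξ i).1 = decide (i ≠ b)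
      · rw [if_neg h1, if_pos h2, hone b hb h2]
        simp
      · rw [if_neg h1, if_neg h2]
        split_ifs <;> norm_num
  have hcard : ∀ ξ : Fin N → Bool × Fin R, ((S.filter fun i => (ξ i).1 = false).card : ℝ) =
      ∑ i ∈ S, if (ξ i).1 = false then 1 else 0 := by
    intro ξ; rw [Finset.sum_boole]
  have hint : ∀ f : (Fin N → Bool × Fin R) → ℝ, Integrable f (coinLaw N R p) :=
    fun f => Integrable.of_finite
  have hpoint : ∀ ξ : Fin N → Bool × Fin R,
      contestValue α L (S.filter fun i => (ξ i).1 = false).card ≤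
      contestValue α L n - α / (4 * L) * (1 - (∑ i ∈ S, if (ξ i).1 = false then 1 else 0) / n) +
        5 / 8 * α * T ξ - (1 - α / 2) * (E a ξ + E b ξ) := by
    intro ξ
    refine (contestValue_le_linear hα0 hS hSN (Finset.card_filter_le _ _)).trans ?_
    rw [← hT ξ, hcard ξ]
    have h1 : (0 : ℝ) ≤ 1 - α / 2 := by linarith [successRate_le_one hp0.le hp1]
    have := mul_le_mul_of_nonneg_left (hE1 ξ) h1
    linarith
  have hTint : ∫ ξ, T ξ ∂(coinLaw N R p) = (p : ℝ) ^ n := by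
    simp only [T]
    rw [integral_coinLaw_prod p S (fun _ x => if x.1 = true then 1 else 0)]
    rw [Finset.prod_congr rfl fun i _ => integral_backoff p (fun b => if b = true then 1 else 0)]
    simp [hn]
  have hEint : ∀ x ∈ S, ∫ ξ, E x ξ ∂(coinLaw N R p) = (1 - p) * (p : ℝ) ^ (n - 1) := by
    intro x hx
    simp only [E]
    rw [integral_coinLaw_prod p S (fun i y => if y.1 = decide (i ≠ x) then 1 else 0)]
    rw [Finset.prod_congr rfl fun i _ =>
      integral_backoff p (fun b => if b = decide (i ≠ x) then 1 else 0)]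
    rw [← Finset.mul_prod_erase S _ hx]
    rw [Finset.prod_congr rfl (g := fun _ => (p : ℝ))]
    · simp [Finset.card_erase_of_mem hx, hn]
    · intro i hi
      simp [(Finset.mem_erase.1 hi).1]
  refine (integral_mono (hint _) (hint _) hpoint).trans ?_
  rw [integral_sub (hint _) (hint _), integral_add (hint _) (hint _), integral_sub (hint _) (hint _),
    integral_const_mul, integral_const_mul, integral_const_mul, integral_sub (hint _) (hint _),
    integral_div, integral_finsetSum _ (fun i _ => hint _), integral_add (hint _) (hint _),
    hTint, hEint a ha, hEint b hb]
  rw [Finset.sum_congr rfl fun i _ =>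
    integral_backoff_apply p i (fun b => if b = false then 1 else 0)]
  have hn0 : (n : ℝ) ≠ 0 := by positivity
  simp only [integral_const, probReal_univ, smul_eq_mul, Finset.sum_const, nsmul_eq_mul, ← hn]
  have hpow : (p : ℝ) ^ n = p * p ^ (n - 1) := by
    rw [← pow_succ']; congr 1; omega
  have h1 : 1 - n * (1 - (p : ℝ)) / n = p := by
    field_simp; ring
  simp only [Bool.true_eq_false, if_false, if_true, mul_zero, zero_add, mul_one, one_mul, h1, hpow]
  have h2p : (0 : ℝ) < 2 - p := by linarith
  have h2 : 1 - α / 2 = 1 / (2 - p) := by rw [hα, successRate]; field_simp; ring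
  have hpp : (0 : ℝ) ≤ (p : ℝ) ^ (n - 1) := by positivity
  -- `successRate` is designed for this comparison: it makes the right side equal to α.
  have h3 : 5 / 8 * α * p ≤ (1 - α / 2) * (2 * (1 - p)) := by
    have h6 : (1 - α / 2) * (2 * (1 - p)) = α := by rw [h2, hα, successRate]; ring
    rw [h6]
    nlinarith
  have h4 := mul_le_mul_of_nonneg_right h3 hpp
  have h5 : α * p / (4 * L) = α / (4 * L) * p := by ring
  rw [h5]
  linarith

end AllocationGame

/-! ### The potential of one context and its drift -/

namespace AllocationGame

variable {N R : ℕ}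

section UpdateLoad

variable {A : Finset (Fin N)} {c : Column N R} {ξ : Fin N → Bool × Fin R} {r : Fin R}

/-- A resource in use gains no new users, since monitoring agents adopt only free resources. Hence
resources in use evolve by back-offs alone. -/
theorem updateColumn_eq_some_iff_of_load_pos (hr : 0 < load A c (some r)) {i : Fin N}
    (hi : i ∈ A) : updateColumn A ξ c i = some r ↔
      c i = some r ∧ ¬ (2 ≤ load A c (some r) ∧ (ξ i).1 = true) := by
  cases hc : c i with
  | none =>
    simp only [updateColumn, hc, reduceCtorEq, false_and, iff_false]
    split_ifs with h
    · intro h'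
      rw [Option.some.inj h'] at h
      omega
    · simp
  | some s =>
    simp only [updateColumn, hc, hi, true_and]
    split_ifs with h
    · refine iff_of_false (by simp) ?_
      rintro ⟨hs, h'⟩
      exact h' (Option.some.inj hs ▸ h)
    · constructor
      · intro hs
        refine ⟨hs, ?_⟩
        rw [← Option.some.inj hs]
        exact h
      · exact fun hs => hs.1

theorem load_updateColumn_of_two_le (hr : 2 ≤ load A c (some r)) :
    load A (updateColumn A ξ c) (some r) =
      ((A.filter fun i => c i = some r).filter fun i => (ξ i).1 = false).card := by
  rw [load, Finset.filter_filter]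
  congr 1
  refine Finset.filter_congr fun i hi => ?_
  rw [updateColumn_eq_some_iff_of_load_pos (by omega) hi]
  simp [hr]

theorem load_updateColumn_of_eq_one (hr : load A c (some r) = 1) :
    load A (updateColumn A ξ c) (some r) = 1 := by
  rw [← hr, load, load]
  congr 1
  refine Finset.filter_congr fun i hi => ?_
  rw [updateColumn_eq_some_iff_of_load_pos (by omega) hi]
  simp [hr]

theorem updateColumn_of_monitors_free (hr : load A c (some r) = 0) {i : Fin N} (hc : c i = none)
    (hξ : (ξ i).2 = r) : updateColumn A ξ c i = some r := by
  simp [updateColumn, hc, hξ, hr]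

theorem updateColumn_of_backoff (hr : 2 ≤ load A c (some r)) {i : Fin N} (hi : i ∈ A)
    (hc : c i = some r) (hξ : (ξ i).1 = true) : updateColumn A ξ c i = none := by
  simp [updateColumn, hc, hi, hr, hξ]

theorem load_le (A : Finset (Fin N)) (c : Column N R) (v : StageAction R) : load A c v ≤ N :=
  (Finset.card_le_univ _).trans (by simp)

/-- If nobody yields after an update, no resource has become free. -/
theorem load_eq_zero_of_updateColumn (h0 : load A (updateColumn A ξ c) none = 0)
    (hr : load A (updateColumn A ξ c) (some r) = 0) : load A c (some r) = 0 := by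
  by_contra hne
  obtain ⟨i, hi, hc⟩ := load_pos_iff.1 (Nat.pos_of_ne_zero hne)
  have h1 := load_eq_zero_iff.1 hr i hi
  rw [Ne, updateColumn_eq_some_iff_of_load_pos (Nat.pos_of_ne_zero hne) hi] at h1
  simp only [hc, true_and, not_not] at h1
  exact load_eq_zero_iff.1 h0 i hi (updateColumn_of_backoff h1.1 hi hc h1.2)

end UpdateLoad

/-- The number of free resources. -/
def frees (A : Finset (Fin N)) (c : Column N R) : ℕ :=
  (Finset.univ.filter fun r => load A c (some r) = 0).card

/-- The number of resources with a collision. -/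
def clashes (A : Finset (Fin N)) (c : Column N R) : ℕ :=
  (Finset.univ.filter fun r => 2 ≤ load A c (some r)).card

theorem frees_add_winners_add_clashes (A : Finset (Fin N)) (c : Column N R) :
    frees A c + (winners A c).card + clashes A c = R := by
  rw [card_winners, frees, clashes]
  simp only [Finset.card_filter]
  rw [← Finset.sum_add_distrib, ← Finset.sum_add_distrib]
  conv_rhs => rw [← Fintype.card_fin R, Fintype.card_eq_sum_ones]
  refine Finset.sum_congr rfl fun r _ => ?_
  rcases (by omega : load A c (some r) = 0 ∨ load A c (some r) = 1 ∨ 2 ≤ load A c (some r))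
    with h | h | h
  · simp [h]
  · simp [h]
  · simp [h, show load A c (some r) ≠ 0 by omega, show load A c (some r) ≠ 1 by omega]

/-- These free resources are unavoidable for lack of agents, which is why `gaps` and `potential`
subtract them. -/
theorem sub_card_le_frees (A : Finset (Fin N)) (c : Column N R) : R - A.card ≤ frees A c := by
  have h1 := frees_add_winners_add_clashes A c
  have h2 := card_eq_load_none_add_sum A c
  have h3 : (winners A c).card + clashes A c ≤ ∑ r, load A c (some r) := by
    rw [card_winners, clashes, Finset.card_filter, Finset.card_filter, ← Finset.sum_add_distrib]
    refine Finset.sum_le_sum fun r _ => ?_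
    split_ifs <;> omega
  omega

theorem frees_le_of_no_yield_of_no_clash {A : Finset (Fin N)} {c : Column N R}
    (h0 : load A c none = 0) (hc : clashes A c = 0) : frees A c ≤ R - A.card := by
  have h1 := frees_add_winners_add_clashes A c
  have h2 := card_eq_load_none_add_sum A c
  have h3 : ∑ r, load A c (some r) ≤ (winners A c).card := by
    rw [card_winners, Finset.card_filter]
    refine Finset.sum_le_sum fun r _ => ?_
    have h4 : ¬ 2 ≤ load A c (some r) := fun h => by
      have := Finset.card_eq_zero.1 hc
      exact Finset.notMem_empty r (this ▸ Finset.mem_filter.2 ⟨Finset.mem_univ r, h⟩)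
    split_ifs <;> omega
  omega

theorem two_le_of_clashes_pos {A : Finset (Fin N)} {c : Column N R} (h : 0 < clashes A c) :
    2 ≤ N := by
  obtain ⟨r, hr⟩ := Finset.card_pos.1 h
  exact (Finset.mem_filter.1 hr).2.trans (load_le A c _)

/-- The number of free resources that can still be filled. -/
noncomputable def gaps (A : Finset (Fin N)) (c : Column N R) : ℝ :=
  frees A c - ((R - A.card : ℕ) : ℝ)

theorem gaps_nonneg (A : Finset (Fin N)) (c : Column N R) : 0 ≤ gaps A c :=
  sub_nonneg.2 (by exact_mod_cast sub_card_le_frees A c)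

theorem gaps_le_frees (A : Finset (Fin N)) (c : Column N R) : gaps A c ≤ frees A c :=
  sub_le_self _ (Nat.cast_nonneg _)

theorem holes_eq (A : Finset (Fin N)) (c : Column N R) :
    (holes A c : ℝ) = clashes A c + gaps A c := by
  have h1 := frees_add_winners_add_clashes A c
  have h2 := card_winners_le A c
  have h3 : holes A c + (R - A.card) = clashes A c + frees A c := by
    unfold holes; omega
  rw [gaps]
  have h4 : (holes A c : ℝ) + ((R - A.card : ℕ) : ℝ) = clashes A c + frees A c := by
    exact_mod_cast h3
  linarith

/-- The potential function of a single context. -/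
noncomputable def potential (α : ℝ) (A : Finset (Fin N)) (c : Column N R) : ℝ :=
  ∑ r, contestValue α (Real.log N) (load A c (some r)) - ((R - A.card : ℕ) : ℝ) +
    α / (8 * R) * (gaps A c * if load A c none = 0 then 1 else 0)

section Bounds

variable {α : ℝ} (h0 : 0 ≤ α) (h1 : α ≤ 1) (A : Finset (Fin N)) (c : Column N R)

include h0 h1

theorem sum_contestValue_le :
    ∑ r, contestValue α (Real.log N) (load A c (some r)) ≤ clashes A c + frees A c := by
  rw [clashes, frees, Finset.card_filter, Finset.card_filter]
  push_cast
  rw [← Finset.sum_add_distrib]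
  refine Finset.sum_le_sum fun r _ => ?_
  rcases (by omega : load A c (some r) = 0 ∨ load A c (some r) = 1 ∨ 2 ≤ load A c (some r))
    with h | h | h
  · simp [h]
  · simp [h]
  · rw [if_pos h, if_neg (by omega), add_zero]
    exact contestValue_le_one h0 h1 (load_le A c _)

theorem le_sum_contestValue :
    clashes A c / 2 + frees A c ≤ ∑ r, contestValue α (Real.log N) (load A c (some r)) := by
  rw [clashes, frees, Finset.card_filter, Finset.card_filter]
  push_cast
  rw [Finset.sum_div, ← Finset.sum_add_distrib]
  refine Finset.sum_le_sum fun r _ => ?_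
  rcases (by omega : load A c (some r) = 0 ∨ load A c (some r) = 1 ∨ 2 ≤ load A c (some r))
    with h | h | h
  · simp [h]
  · simp [h]
  · rw [if_pos h, if_neg (by omega), add_zero]
    exact half_le_contestValue h0 h1 h

theorem holes_le_two_mul_potential : (holes A c : ℝ) ≤ 2 * potential α A c := by
  have h2 := le_sum_contestValue h0 h1 A c
  have h3 := gaps_nonneg A c
  have h4 : 0 ≤ α / (8 * R) * (gaps A c * if load A c none = 0 then 1 else 0) := by
    refine mul_nonneg (by positivity) (mul_nonneg h3 ?_)
    split_ifs <;> norm_num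
  rw [holes_eq, potential]
  have : gaps A c = frees A c - ((R - A.card : ℕ) : ℝ) := rfl
  linarith

theorem potential_le_two_mul_holes : potential α A c ≤ 2 * holes A c := by
  have h2 := sum_contestValue_le h0 h1 A c
  have h3 := gaps_nonneg A c
  have h5 : α / (8 * R) ≤ 1 := by
    rcases Nat.eq_zero_or_pos R with rfl | hR
    · simp
    · have : (1 : ℝ) ≤ R := by exact_mod_cast hR
      rw [div_le_one (by positivity)]
      linarith
  have h4 : α / (8 * R) * (gaps A c * if load A c none = 0 then 1 else 0) ≤ gaps A c := by
    split_ifs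
    · rw [mul_one]; exact mul_le_of_le_one_left h3 h5
    · simpa using h3
  rw [holes_eq, potential]
  have : gaps A c = frees A c - ((R - A.card : ℕ) : ℝ) := rfl
  have h6 : (0 : ℝ) ≤ clashes A c := Nat.cast_nonneg _
  linarith

end Bounds

section Drift

variable [NeZero R] {p : unitInterval} (hp0 : 0 < (p : ℝ)) (hp1 : (p : ℝ) < 1)
  (A : Finset (Fin N)) (c : Column N R)

include hp0 hp1

/-- A free resource is monitored by a given yielding agent with probability 1/R and then drops by at
least α/4; a collision decays by back-offs; a success is permanent. -/
theorem integral_contestValue_update_le (r : Fin R) :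
    ∫ ξ, contestValue (successRate p) (Real.log N) (load A (updateColumn A ξ c) (some r))
      ∂(coinLaw N R p) ≤
      contestValue (successRate p) (Real.log N) (load A c (some r)) -
        successRate p * p / (4 * Real.log N) * (if 2 ≤ load A c (some r) then 1 else 0) -
        successRate p / (4 * R) * (if load A c none = 0 then 0 else 1) *
          (if load A c (some r) = 0 then 1 else 0) := by
  have hα0 := (successRate_pos hp1).le
  have hα1 := successRate_le_one hp0.le hp1
  rcases (by omega : load A c (some r) = 0 ∨ load A c (some r) = 1 ∨ 2 ≤ load A c (some r))
    with h | h | h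
  · by_cases hy : load A c none = 0
    · simp only [h, hy, contestValue_zero, if_true]
      refine (integral_mono (g := fun _ => (1 : ℝ)) Integrable.of_finite Integrable.of_finite
        fun ξ => contestValue_le_one hα0 hα1 (load_le _ _ _)).trans ?_
      simp
    · obtain ⟨i, hi, hc⟩ := load_pos_iff.1 (Nat.pos_of_ne_zero hy)
      have hpoint : ∀ ξ : Fin N → Bool × Fin R,
          contestValue (successRate p) (Real.log N) (load A (updateColumn A ξ c) (some r)) ≤
            1 - successRate p / 4 * (if (ξ i).2 = r then 1 else 0) := by
        intro ξ
        split_ifs with hξ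
        · rw [mul_one]
          refine contestValue_le hα0 hα1 (Nat.pos_iff_ne_zero.1 ?_) (load_le _ _ _)
          exact load_pos_iff.2 ⟨i, hi, updateColumn_of_monitors_free h hc hξ⟩
        · rw [mul_zero, sub_zero]
          exact contestValue_le_one hα0 hα1 (load_le _ _ _)
      refine (integral_mono Integrable.of_finite Integrable.of_finite hpoint).trans ?_
      rw [integral_sub Integrable.of_finite Integrable.of_finite, integral_const_mul,
        integral_monitor_apply]
      simp only [h, hy, contestValue_zero, if_true, if_false]
      refine le_of_eq ?_
      simp
      field_simp
  · simp [h, load_updateColumn_of_eq_one h]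
  · simp only [load_updateColumn_of_two_le h]
    refine (integral_contestValue_survivors_le hp0 hp1 _ h).trans (le_of_eq ?_)
    simp [h, show load A c (some r) ≠ 0 by omega]
    rfl

omit hp0 hp1 in
-- If nobody yields after the update then nobody backed off, so no new gap has opened. If nobody
-- yielded before it but some resource is contested, one of its users backs off with probability p
-- and the product vanishes.
theorem integral_gaps_update_le :
    ∫ ξ, gaps A (updateColumn A ξ c) * (if load A (updateColumn A ξ c) none = 0 then 1 else 0)
      ∂(coinLaw N R p) ≤ gaps A c * (if load A c none = 0 then 1 - (p : ℝ) else 1) := by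
  have hpoint : ∀ ξ : Fin N → Bool × Fin R,
      gaps A (updateColumn A ξ c) * (if load A (updateColumn A ξ c) none = 0 then 1 else 0) ≤
        gaps A c := by
    intro ξ
    split_ifs with h
    · rw [mul_one, gaps, gaps]
      refine sub_le_sub_right ?_ _
      exact_mod_cast Finset.card_le_card fun r hr => by
        simp only [Finset.mem_filter, Finset.mem_univ, true_and] at hr ⊢
        exact load_eq_zero_of_updateColumn h hr
    · simpa using gaps_nonneg A c
  -- With neither yielding agents nor collisions there are no gaps, so only this case needs a coin.
  by_cases hbad : load A c none = 0 ∧ 0 < clashes A c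
  · obtain ⟨r, hr⟩ := Finset.card_pos.1 hbad.2
    have hr2 := (Finset.mem_filter.1 hr).2
    obtain ⟨i, hi, hc⟩ := load_pos_iff.1 (by omega : 0 < load A c (some r))
    have hpoint' : ∀ ξ : Fin N → Bool × Fin R,
        gaps A (updateColumn A ξ c) * (if load A (updateColumn A ξ c) none = 0 then 1 else 0) ≤
          gaps A c * (if (ξ i).1 = false then 1 else 0) := by
      intro ξ
      cases hξ : (ξ i).1 with
      | false => simpa using hpoint ξ
      | true =>
        have := load_pos_iff.2 ⟨i, hi, updateColumn_of_backoff hr2 hi hc hξ⟩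
        simp [this.ne']
    refine (integral_mono Integrable.of_finite Integrable.of_finite hpoint').trans ?_
    rw [integral_const_mul, integral_backoff_apply p i (fun b => if b = false then 1 else 0)]
    simp [hbad.1]
  · refine (integral_mono (g := fun _ => gaps A c) Integrable.of_finite Integrable.of_finite
      hpoint).trans ?_
    simp only [integral_const, probReal_univ, one_smul]
    split_ifs with hy
    · have hzero : gaps A c = 0 := by
        refine le_antisymm ?_ (gaps_nonneg A c)
        rw [gaps, sub_nonpos]
        exact_mod_cast frees_le_of_no_yield_of_no_clash hy (by
          by_contra h; exact hbad ⟨hy, Nat.pos_of_ne_zero h⟩)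
      simp [hzero]
    · simp

/-- Collisions decay by themselves. Gaps decay through the value of free resources if somebody
yields, and through the surcharge otherwise. The conditions involving log N and p are needed only
for collisions, which require two agents. -/
theorem integral_potential_update_le {ρ : ℝ} (hρ1 : ρ ≤ successRate p / (16 * R))
    (hρ2 : 2 ≤ N → ρ ≤ successRate p * p / (16 * R))
    (hρ3 : 2 ≤ N → ρ ≤ successRate p * p / (4 * Real.log N)) (hρ : 0 ≤ ρ) :
    ∫ ξ, potential (successRate p) A (updateColumn A ξ c) ∂(coinLaw N R p) ≤
      (1 - ρ) * potential (successRate p) A c := by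
  have hα0 := (successRate_pos hp1).le
  have hα1 := successRate_le_one hp0.le hp1
  set α := successRate p with hα
  set d : ℝ := ((R - A.card : ℕ) : ℝ) with hd
  have hR : (0 : ℝ) < R := by exact_mod_cast Nat.pos_of_ne_zero (NeZero.ne R)
  have hsum : ∑ r, ∫ ξ, contestValue α (Real.log N) (load A (updateColumn A ξ c) (some r))
      ∂(coinLaw N R p) ≤
      ∑ r, contestValue α (Real.log N) (load A c (some r)) -
        α * p / (4 * Real.log N) * clashes A c -
        α / (4 * R) * (if load A c none = 0 then 0 else 1) * frees A c := by
    refine (Finset.sum_le_sum fun r _ =>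
      integral_contestValue_update_le hp0 hp1 A c r).trans (le_of_eq ?_)
    rw [Finset.sum_sub_distrib, Finset.sum_sub_distrib, ← Finset.mul_sum, ← Finset.mul_sum,
      Finset.sum_boole, Finset.sum_boole]
    rfl
  have hgap := integral_gaps_update_le (p := p) A c
  have hint : ∫ ξ, potential α A (updateColumn A ξ c) ∂(coinLaw N R p) =
      ∑ r, ∫ ξ, contestValue α (Real.log N) (load A (updateColumn A ξ c) (some r))
        ∂(coinLaw N R p) - d + α / (8 * R) *
      ∫ ξ, gaps A (updateColumn A ξ c) *
        (if load A (updateColumn A ξ c) none = 0 then 1 else 0) ∂(coinLaw N R p) := by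
    simp only [potential]
    rw [integral_add Integrable.of_finite Integrable.of_finite,
      integral_sub Integrable.of_finite Integrable.of_finite, integral_const_mul,
      integral_finsetSum _ fun _ _ => Integrable.of_finite]
    simp [hd]
  have hβ : 0 ≤ α / (8 * R) := by positivity
  have hgap' := mul_le_mul_of_nonneg_left hgap hβ
  have hle := sum_contestValue_le hα0 hα1 A c
  have hx0 := gaps_nonneg A c
  have hx : gaps A c = frees A c - d := rfl
  have hxf := gaps_le_frees A c
  have hc0 : (0 : ℝ) ≤ clashes A c := Nat.cast_nonneg _
  have hclash : ρ * clashes A c ≤ α * p / (4 * Real.log N) * clashes A c := by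
    rcases Nat.eq_zero_or_pos (clashes A c) with h | h
    · simp [h]
    · exact mul_le_mul_of_nonneg_right (hρ3 (two_le_of_clashes_pos h)) hc0
  rw [hint, potential]
  by_cases hy : load A c none = 0
  · simp only [hy, if_true, mul_zero, zero_mul, sub_zero, mul_one] at hsum hgap' ⊢
    -- The factor 2 is because each gap now counts up to twice in the potential: as a free resource
    -- and in the surcharge.
    have hgapρ : 2 * ρ * gaps A c ≤ α / (8 * R) * p * gaps A c := by
      rcases Nat.eq_zero_or_pos (clashes A c) with h | h
      · have hzero : gaps A c = 0 := by
          refine le_antisymm ?_ hx0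
          rw [gaps, sub_nonpos]
          exact_mod_cast frees_le_of_no_yield_of_no_clash hy h
        simp [hzero]
      · refine mul_le_mul_of_nonneg_right ?_ hx0
        have h2 := hρ2 (two_le_of_clashes_pos h)
        have h3 : α * p / (16 * R) = α / (8 * R) * p / 2 := by field_simp; ring
        linarith
    have hβ1 : α / (8 * R) * gaps A c ≤ gaps A c := by
      refine mul_le_of_le_one_left hx0 ?_
      rw [div_le_one (by positivity)]
      have : (1 : ℝ) ≤ R := by exact_mod_cast Nat.pos_of_ne_zero (NeZero.ne R)
      linarith
    have h4 : ρ * (∑ r, contestValue α (Real.log N) (load A c (some r)) - d +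
        α / (8 * R) * gaps A c) ≤ ρ * (clashes A c + 2 * gaps A c) :=
      mul_le_mul_of_nonneg_left (by linarith) hρ
    linarith
  · simp only [hy, if_false, mul_zero, mul_one, add_zero] at hsum hgap' ⊢
    -- The gain from monitoring is twice the weight of the surcharge: one half pays for a surcharge
    -- that may appear after the update, the other half is the contraction.
    have h3 : α / (4 * R) * frees A c = 2 * (α / (8 * R)) * frees A c := by field_simp; ring
    have h5 : α / (8 * R) * gaps A c ≤ α / (8 * R) * frees A c :=
      mul_le_mul_of_nonneg_left hxf hβ
    have h6 : ρ * gaps A c ≤ α / (8 * R) * gaps A c := by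
      refine mul_le_mul_of_nonneg_right (hρ1.trans ?_) hx0
      gcongr
      norm_num
    have h4 : ρ * (∑ r, contestValue α (Real.log N) (load A c (some r)) - d) ≤
        ρ * (clashes A c + gaps A c) :=
      mul_le_mul_of_nonneg_left (by linarith) hρ
    linarith

end Drift

end AllocationGame

/-! ### The cost of departing agents -/

namespace AllocationGame

variable {N R : ℕ}

theorem sum_inv_load (A : Finset (Fin N)) (c : Column N R) :
    ∑ a ∈ A, (load A c (c a) : ℝ)⁻¹ = (A.image c).card := by
  rw [← Finset.sum_fiberwise_of_maps_to (t := A.image c)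
    (fun a ha => Finset.mem_image_of_mem c ha), Finset.card_eq_sum_ones, Nat.cast_sum]
  refine Finset.sum_congr rfl fun v hv => ?_
  obtain ⟨a, ha, hav⟩ := Finset.mem_image.1 hv
  have hpos : (load A c v : ℝ) ≠ 0 := by
    exact_mod_cast (load_pos_iff.2 ⟨a, ha, hav⟩).ne'
  rw [Finset.sum_congr rfl (g := fun _ => (load A c v : ℝ)⁻¹) fun b hb => by
    rw [(Finset.mem_filter.1 hb).2]]
  rw [Finset.sum_const, nsmul_eq_mul, ← load, mul_inv_cancel₀ hpos, Nat.cast_one]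

/-- The actions whose users all leave when the set of agents shrinks from `A` to `A'`. -/
def lostActions (A A' : Finset (Fin N)) (c : Column N R) : Finset (StageAction R) :=
  Finset.univ.filter fun v => 0 < load A c v ∧ load A' c v = 0

/-- An action is lost only if all its users leave, and these together contribute load · load⁻¹ = 1.
Unlike the count of lost actions, the right side is additive over agents, which makes
exchangeability applicable. -/
theorem card_lostActions_le (A A' : Finset (Fin N)) (c : Column N R) :
    ((lostActions A A' c).card : ℝ) ≤ ∑ a ∈ A \ A', (load A c (c a) : ℝ)⁻¹ := by
  rw [← Finset.sum_fiberwise (A \ A') c, Finset.card_eq_sum_ones, Nat.cast_sum]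
  refine (Finset.sum_le_sum fun v hv => ?_).trans
    (Finset.sum_le_sum_of_subset_of_nonneg (Finset.subset_univ (lostActions A A' c))
      fun v _ _ => Finset.sum_nonneg fun a _ => by positivity)
  obtain ⟨h1, h2⟩ := (Finset.mem_filter.1 hv).2
  have hfilter : ((A \ A').filter fun a => c a = v) = A.filter fun a => c a = v := by
    ext a
    simp only [Finset.mem_filter, Finset.mem_sdiff]
    exact ⟨fun h => ⟨h.1.1, h.2⟩, fun h => ⟨⟨h.1, fun h' => load_eq_zero_iff.1 h2 a h' h.2⟩, h.2⟩⟩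
  rw [Finset.sum_congr rfl (g := fun _ => (load A c v : ℝ)⁻¹) fun b hb => by
    rw [(Finset.mem_filter.1 hb).2]]
  rw [hfilter, Finset.sum_const, nsmul_eq_mul, ← load,
    mul_inv_cancel₀ (by exact_mod_cast h1.ne'), Nat.cast_one]

theorem card_lostActions (A A' : Finset (Fin N)) (c : Column N R) :
    ((lostActions A A' c).card : ℝ) = (if none ∈ lostActions A A' c then 1 else 0) +
      ∑ r, if some r ∈ lostActions A A' c then 1 else 0 := by
  rw [← Fintype.sum_option (fun v => if v ∈ lostActions A A' c then (1 : ℝ) else 0),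
    Finset.sum_boole]
  simp

/-- The potential grows by at most twice the number of lost actions when agents leave. -/
theorem potential_le_of_subset {α : ℝ} (h0 : 0 ≤ α) (h1 : α ≤ 1) {A A' : Finset (Fin N)}
    (hA : A' ⊆ A) (c : Column N R) :
    potential α A' c ≤ potential α A c + 2 * ∑ a ∈ A \ A', (load A c (c a) : ℝ)⁻¹ := by
  set ℓ : ℝ := ∑ r, if some r ∈ lostActions A A' c then 1 else 0 with hℓ
  have hℓ0 : 0 ≤ ℓ := Finset.sum_nonneg fun r _ => by split_ifs <;> norm_num
  have hcard := card_lostActions A A' c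
  have hle := card_lostActions_le A A' c
  rw [← hℓ] at hcard
  have hlost : ∀ v, v ∈ lostActions A A' c ↔ 0 < load A c v ∧ load A' c v = 0 := by
    simp [lostActions]
  have hsum : ∑ r, contestValue α (Real.log N) (load A' c (some r)) ≤
      ∑ r, contestValue α (Real.log N) (load A c (some r)) + ℓ := by
    rw [hℓ, ← Finset.sum_add_distrib]
    refine Finset.sum_le_sum fun r _ => ?_
    have hm := load_mono hA c (some r)
    by_cases hr : some r ∈ lostActions A A' c
    · rw [if_pos hr, ((hlost _).1 hr).2]
      have := contestValue_nonneg (N := N) h0 h1 (load A c (some r))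
      simp only [contestValue_zero]
      linarith
    · rw [if_neg hr, add_zero]
      rw [hlost] at hr
      -- Fewer users never raise the value unless the resource becomes free.
      rcases (by omega : load A' c (some r) = load A c (some r) ∨ load A' c (some r) = 1 ∨
        2 ≤ load A' c (some r)) with h | h | h
      · rw [h]
      · rw [h, contestValue_one]
        exact contestValue_nonneg h0 h1 _
      · exact contestValue_mono h0 h hm
  have hd : ((R - A.card : ℕ) : ℝ) ≤ ((R - A'.card : ℕ) : ℝ) := by
    exact_mod_cast Nat.sub_le_sub_left (Finset.card_le_card hA) R
  have hfrees : (frees A' c : ℝ) ≤ frees A c + ℓ := by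
    rw [hℓ, frees, frees, Finset.card_filter, Finset.card_filter]
    push_cast
    rw [← Finset.sum_add_distrib]
    refine Finset.sum_le_sum fun r _ => ?_
    simp only [hlost]
    by_cases h2 : load A' c (some r) = 0
    · by_cases h3 : load A c (some r) = 0
      · simp [h2, h3]
      · simp [h2, h3, Nat.pos_of_ne_zero h3]
    · simp only [h2, if_false]
      split_ifs <;> norm_num
  have hR : (frees A' c : ℝ) ≤ R := by
    have := frees_add_winners_add_clashes A' c
    exact_mod_cast (by omega : frees A' c ≤ R)
  have hβ : 0 ≤ α / (8 * R) := by positivity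
  have hβR : α / (8 * R) * R ≤ 1 := by
    rcases Nat.eq_zero_or_pos R with rfl | hR
    · simp
    · have : (0 : ℝ) < R := by exact_mod_cast hR
      rw [div_mul_eq_mul_div, div_le_one (by positivity)]
      nlinarith
  have hβ1 : α / (8 * R) ≤ 1 := by
    rcases Nat.eq_zero_or_pos R with rfl | hR
    · simp
    · have : (1 : ℝ) ≤ R := by exact_mod_cast hR
      rw [div_le_one (by positivity)]
      linarith
  have hg := gaps_nonneg A c
  have hlast : α / (8 * R) * (gaps A' c * if load A' c none = 0 then 1 else 0) ≤
      α / (8 * R) * (gaps A c * if load A c none = 0 then 1 else 0) + ℓ +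
        (if none ∈ lostActions A A' c then 1 else 0) := by
    by_cases hy' : load A' c none = 0
    · by_cases hy : load A c none = 0
      · simp only [hy', hy, hlost, if_true, mul_one, lt_irrefl, false_and, if_false, add_zero]
        have : gaps A' c ≤ gaps A c + ℓ := by unfold gaps; linarith
        have h2 := mul_le_mul_of_nonneg_left this hβ
        have h3 := mul_le_of_le_one_left hℓ0 hβ1
        linarith
      · simp only [hy', hy, hlost, if_true, mul_one, Nat.pos_of_ne_zero hy, and_self, if_false,
          mul_zero, zero_add]
        -- If the last yielding agents leave, the whole surcharge may appear at once; it is at most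
        -- 1 and is charged to the lost action of yielding.
        have := mul_le_mul_of_nonneg_left ((gaps_le_frees A' c).trans hR) hβ
        linarith
    · simp only [hy', if_false, mul_zero]
      have : 0 ≤ α / (8 * R) * (gaps A c * if load A c none = 0 then 1 else 0) := by
        refine mul_nonneg hβ (mul_nonneg hg ?_)
        split_ifs <;> norm_num
      have h2 : (0 : ℝ) ≤ if none ∈ lostActions A A' c then 1 else 0 := by
        split_ifs <;> norm_num
      linarith
  have hnone : (0 : ℝ) ≤ if none ∈ lostActions A A' c then 1 else 0 := by
    split_ifs <;> norm_num
  unfold potential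
  linarith

end AllocationGame

/-! ### Independence of the coins and symmetry between agents -/

namespace AllocationGame

variable {N R K : ℕ}

section Resampling

variable {ι X : Type*} [MeasurableSpace X] [DecidableEq ι]

/-- Replacing one coordinate of an independent family by an independent copy preserves the law. -/
theorem measurePreserving_update_infinitePi (ν : Measure X) [IsProbabilityMeasure ν] (t : ι) :
    MeasurePreserving (fun q : (ι → X) × X => Function.update q.1 t q.2)
      ((Measure.infinitePi fun _ : ι => ν).prod ν) (Measure.infinitePi fun _ : ι => ν) := by
  have hmeas : Measurable fun q : (ι → X) × X => Function.update q.1 t q.2 := by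
    refine measurable_pi_iff.2 fun i => ?_
    by_cases h : i = t
    · subst h
      simpa using measurable_snd
    · simp only [Function.update_of_ne h]
      exact (measurable_pi_apply i).comp measurable_fst
  refine ⟨hmeas, Measure.eq_infinitePi _ fun s B hB => ?_⟩
  rw [Measure.map_apply hmeas (MeasurableSet.pi s.countable_toSet fun i _ => hB i)]
  have hpre : (fun q : (ι → X) × X => Function.update q.1 t q.2) ⁻¹' ((s : Set ι).pi B) =
      ((s.erase t : Finset ι) : Set ι).pi B ×ˢ (if t ∈ s then B t else Set.univ) := by
    ext ⟨x, ξ⟩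
    simp only [Set.mem_preimage, Set.mem_pi, Set.mem_prod, Finset.mem_coe, Finset.mem_erase]
    constructor
    · intro h
      refine ⟨fun i hi => by simpa [Function.update_of_ne hi.1] using h i hi.2, ?_⟩
      split_ifs with ht
      · simpa using h t ht
      · trivial
    · rintro ⟨h1, h2⟩ i hi
      by_cases h : i = t
      · subst h
        simpa [hi] using h2
      · simpa [Function.update_of_ne h] using h1 i ⟨h, hi⟩
  rw [hpre, Measure.prod_prod, Measure.infinitePi_pi _ fun i _ => hB i]
  split_ifs with ht
  · rw [mul_comm, Finset.mul_prod_erase s (fun i => ν (B i)) ht]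
  · rw [measure_univ, mul_one, Finset.erase_eq_of_notMem ht]

omit [DecidableEq ι] in
theorem measurePreserving_comp_perm [Fintype ι] (ν : Measure X) [IsProbabilityMeasure ν]
    (s : Equiv.Perm ι) :
    MeasurePreserving (fun (x : ι → X) i => x (s i)) (Measure.pi fun _ => ν)
      (Measure.pi fun _ => ν) := by
  have h := measurePreserving_piCongrLeft (fun _ : ι => ν) s.symm
  convert h using 1
  funext x i
  simp [MeasurableEquiv.piCongrLeft, Equiv.piCongrLeft_apply]

end Resampling

variable [NeZero R] [NeZero K] (p : unitInterval)

instance : IsProbabilityMeasure (runLaw N R K p) := by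
  unfold runLaw; infer_instance

omit [NeZero K] in
theorem measurePreserving_resample (t : ℕ) :
    MeasurePreserving (fun q : Randomness N R K × (Fin N → Bool × Fin R) =>
      ((q.1.1, Function.update q.1.2 t q.2) : Randomness N R K))
      ((runLaw N R K p).prod (coinLaw N R p)) (runLaw N R K p) := by
  have h1 := (MeasurePreserving.id (Measure.pi fun _ : Fin N => Measure.pi fun _ : Fin K =>
      (PMF.uniformOfFintype (StageAction R)).toMeasure)).prod
    (measurePreserving_update_infinitePi (coinLaw N R p) t)
  have h2 := measurePreserving_prodAssoc (Measure.pi fun _ : Fin N => Measure.pi fun _ : Fin K =>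
      (PMF.uniformOfFintype (StageAction R)).toMeasure)
    (Measure.infinitePi fun _ : ℕ => coinLaw N R p) (coinLaw N R p)
  exact h1.comp h2

section Measurability

variable {Ω : Type*} [MeasurableSpace Ω]

omit [NeZero R] in
theorem measurable_active {c : Ω → ℕ → Column N R} (hc : ∀ k, Measurable fun ω => c ω k) (k : ℕ) :
    Measurable fun ω => active (c ω) k := by
  induction k with
  | zero => exact measurable_const
  | succ k ih =>
    exact (Measurable.of_discrete (f := fun q : Finset (Fin N) × Column N R =>
      q.1 \ winners q.1 q.2)).comp (ih.prodMk (hc k))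

omit [NeZero R] in
theorem measurable_runColumns (e k : ℕ) :
    Measurable fun ω : Randomness N R K => runColumns ω e k := by
  induction e generalizing k with
  | zero =>
    refine measurable_pi_iff.2 fun n => ?_
    exact (measurable_pi_apply _).comp ((measurable_pi_apply n).comp measurable_fst)
  | succ e ih =>
    exact (Measurable.of_discrete
      (f := fun q : Finset (Fin N) × (Fin N → Bool × Fin R) × Column N R =>
        updateColumn q.1 q.2.1 q.2.2)).comp ((measurable_active ih k).prodMk
      (((measurable_pi_apply _).comp measurable_snd).prodMk (ih k)))

omit [NeZero R] in
theorem measurable_active_runColumns (e k : ℕ) :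
    Measurable fun ω : Randomness N R K => active (runColumns ω e) k :=
  measurable_active (measurable_runColumns e) k

end Measurability

theorem integrable_comp_of_finite {Ω β : Type*} [MeasurableSpace Ω] (μ : Measure Ω)
    [IsFiniteMeasure μ] [MeasurableSpace β] [DiscreteMeasurableSpace β] [Finite β] {X : Ω → β}
    (hX : Measurable X) (G : β → ℝ) : Integrable (fun ω => G (X ω)) μ := by
  have : IsFiniteMeasure (μ.map X) := Measure.isFiniteMeasure_map μ X
  exact (Integrable.of_finite (μ := μ.map X) (f := G)).comp_measurable hX

omit [NeZero K] in
/-- The random choices of a time-step are independent of the past. -/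
theorem integral_resample {β : Type*} [MeasurableSpace β] [DiscreteMeasurableSpace β] [Finite β]
    {X : Randomness N R K → β} (hX : Measurable X) {t : ℕ}
    (hinv : ∀ ω ξ, X (ω.1, Function.update ω.2 t ξ) = X ω)
    (H : β → (Fin N → Bool × Fin R) → ℝ) :
    ∫ ω, H (X ω) (ω.2 t) ∂(runLaw N R K p) =
      ∫ ω, ∫ ξ, H (X ω) ξ ∂(coinLaw N R p) ∂(runLaw N R K p) := by
  have hmp := measurePreserving_resample (N := N) (R := R) (K := K) p t
  have hcoin : Measurable fun ω : Randomness N R K => ω.2 t :=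
    (measurable_pi_apply t).comp measurable_snd
  have hI := integrable_comp_of_finite (runLaw N R K p) (hX.prodMk hcoin) (fun q => H q.1 q.2)
  have hI2 : Integrable (fun q : Randomness N R K × (Fin N → Bool × Fin R) => H (X q.1) q.2)
      ((runLaw N R K p).prod (coinLaw N R p)) :=
    integrable_comp_of_finite _ ((hX.comp measurable_fst).prodMk measurable_snd)
      (fun q => H q.1 q.2)
  rw [← integral_prod _ hI2]
  conv_lhs => rw [← hmp.map_eq]
  rw [integral_map hmp.measurable.aemeasurable (by rw [hmp.map_eq]; exact hI.1)]
  simp [hinv]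

omit [NeZero R] in
-- The strategies at the start of episode e use only coins from time-steps before e * K.
theorem runColumns_update (ω : Randomness N R K) {e k t : ℕ} (ξ : Fin N → Bool × Fin R)
    (hk : k < K) (ht : e * K ≤ t) :
    runColumns (ω.1, Function.update ω.2 t ξ) e k = runColumns ω e k := by
  induction e generalizing k with
  | zero => rfl
  | succ e ih =>
    rw [Nat.succ_mul] at ht
    have hact : ∀ j ≤ k, active (runColumns (ω.1, Function.update ω.2 t ξ) e) j =
        active (runColumns ω e) j := by
      intro j hj
      induction j with
      | zero => rfl
      | succ j ihj => rw [active, active, ihj (by omega), ih (by omega) (by omega)]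
    simp only [runColumns]
    rw [hact k le_rfl, ih hk (by omega), Function.update_of_ne (by omega)]

omit [NeZero R] in
theorem active_update (ω : Randomness N R K) {e k t : ℕ} (ξ : Fin N → Bool × Fin R)
    (hk : k < K) (ht : e * K ≤ t) :
    active (runColumns (ω.1, Function.update ω.2 t ξ) e) k = active (runColumns ω e) k := by
  induction k with
  | zero => rfl
  | succ k ih => rw [active, active, ih (by omega), runColumns_update ω ξ (by omega) ht]

theorem integral_runColumns_succ {e k : ℕ} (hk : k < K) (G : Finset (Fin N) → Column N R → ℝ) :
    ∫ ω, G (active (runColumns ω e) k) (runColumns ω (e + 1) k) ∂(runLaw N R K p) =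
      ∫ ω, ∫ ξ, G (active (runColumns ω e) k)
        (updateColumn (active (runColumns ω e) k) ξ (runColumns ω e k)) ∂(coinLaw N R p)
        ∂(runLaw N R K p) :=
  integral_resample p (X := fun ω => (active (runColumns ω e) k, runColumns ω e k))
    ((measurable_active_runColumns e k).prodMk (measurable_runColumns e k))
    (t := e * K + k)
    (fun ω ξ => by rw [runColumns_update ω ξ hk (by omega), active_update ω ξ hk (by omega)])
    fun q ξ => G q.1 (updateColumn q.1 ξ q.2)

section Swap

/-- Exchange the roles of two agents in a single context. -/
def swapAgents (k : Fin K) (a b : Fin N) (ω : Randomness N R K) : Randomness N R K :=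
  (fun n j => ω.1 (if j = k then Equiv.swap a b n else n) j,
    fun t n => ω.2 t (if contextAt K t = k then Equiv.swap a b n else n))

theorem measurePreserving_swapAgents (k : Fin K) (a b : Fin N) :
    MeasurePreserving (swapAgents k a b) (runLaw N R K p) (runLaw N R K p) := by
  set μ := Measure.pi fun _ : Fin N => Measure.pi fun _ : Fin K =>
      (PMF.uniformOfFintype (StageAction R)).toMeasure with hμ
  have h1 : MeasurePreserving (fun (x : Fin N → Fin K → StageAction R) n j =>
      x (if j = k then Equiv.swap a b n else n) j) μ μ := by
    -- The initial strategies are uniform on a finite set: all singletons have equal mass, so every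
    -- bijection preserves the law.
    have hsingle : ∀ x, μ {x} = ∏ _n : Fin N, ∏ _j : Fin K, ((R : ℝ≥0∞) + 1)⁻¹ := by
      intro x
      rw [hμ, Measure.pi_singleton]
      refine Finset.prod_congr rfl fun n _ => ?_
      rw [Measure.pi_singleton]
      refine Finset.prod_congr rfl fun j _ => ?_
      rw [PMF.toMeasure_apply_singleton _ _ (measurableSet_singleton _)]
      simp
    refine ⟨Measurable.of_discrete, Measure.ext_of_singleton fun x => ?_⟩
    rw [Measure.map_apply Measurable.of_discrete (measurableSet_singleton _)]
    have hpre : (fun (x : Fin N → Fin K → StageAction R) n j =>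
        x (if j = k then Equiv.swap a b n else n) j) ⁻¹' {x} =
        {fun n j => x (if j = k then Equiv.swap a b n else n) j} := by
      ext y
      simp only [Set.mem_preimage, Set.mem_singleton_iff]
      constructor <;> rintro rfl <;> funext n j <;> by_cases h : j = k <;> simp [h]
    rw [hpre, hsingle, hsingle]
  have h2 : MeasurePreserving (fun (x : ℕ → Fin N → Bool × Fin R) t n =>
      x t (if contextAt K t = k then Equiv.swap a b n else n))
      (Measure.infinitePi fun _ : ℕ => coinLaw N R p)
      (Measure.infinitePi fun _ : ℕ => coinLaw N R p) := by
    have hf : ∀ t : ℕ, MeasurePreserving (fun (x : Fin N → Bool × Fin R) n =>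
        x (if contextAt K t = k then Equiv.swap a b n else n)) (coinLaw N R p) (coinLaw N R p) := by
      intro t
      by_cases h : contextAt K t = k
      · simp only [h, if_true]
        exact measurePreserving_comp_perm _ (Equiv.swap a b)
      · simp only [h, if_false]
        exact MeasurePreserving.id _
    refine ⟨measurable_pi_iff.2 fun t => (hf t).measurable.comp (measurable_pi_apply t), ?_⟩
    rw [Measure.infinitePi_map_pi (X := fun _ : ℕ => Fin N → Bool × Fin R)
      (f := fun t x n => x (if contextAt K t = k then Equiv.swap a b n else n)) _
      fun t => (hf t).measurable]
    simp only [(hf _).map_eq]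
  exact h1.prod h2

omit [NeZero R]

theorem load_comp_perm {A : Finset (Fin N)} {s : Equiv.Perm (Fin N)} (hs : ∀ i, s i ∈ A ↔ i ∈ A)
    (c : Column N R) (v : StageAction R) : load A (fun i => c (s i)) v = load A c v := by
  refine Finset.card_equiv s fun i => ?_
  simp [hs]

theorem updateColumn_comp_perm {A : Finset (Fin N)} {s : Equiv.Perm (Fin N)}
    (hs : ∀ i, s i ∈ A ↔ i ∈ A) (ξ : Fin N → Bool × Fin R) (c : Column N R) :
    updateColumn A (fun i => ξ (s i)) (fun i => c (s i)) = fun i => updateColumn A ξ c (s i) := by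
  funext i
  simp only [updateColumn, load_comp_perm hs, hs]

theorem swap_mem_iff {A : Finset (Fin N)} {a b : Fin N} (ha : a ∈ A) (hb : b ∈ A) (i : Fin N) :
    Equiv.swap a b i ∈ A ↔ i ∈ A := by
  rcases eq_or_ne i a with rfl | h1
  · simp [ha, hb]
  · rcases eq_or_ne i b with rfl | h2
    · simp [ha, hb]
    · rw [Equiv.swap_apply_of_ne_of_ne h1 h2]

/-- Information flows only from earlier to later contexts, so contexts before k do not notice an
exchange in context k. In particular the active set of context k itself is unchanged. -/
theorem runColumns_swapAgents_of_lt (ω : Randomness N R K) (k : Fin K) (a b : Fin N) (e : ℕ)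
    {j : ℕ} (hj : j < k) : runColumns (swapAgents k a b ω) e j = runColumns ω e j := by
  induction e generalizing j with
  | zero =>
    have hne : Fin.ofNat K j ≠ k := fun h => by
      have := congrArg Fin.val h
      simp [Fin.ofNat, Nat.mod_eq_of_lt (hj.trans k.2)] at this
      omega
    funext n
    simp only [runColumns, swapAgents, hne, if_false]
  | succ e ih =>
    have hact : ∀ i ≤ j, active (runColumns (swapAgents k a b ω) e) i =
        active (runColumns ω e) i := by
      intro i hi
      induction i with
      | zero => rfl
      | succ i ihi => rw [active, active, ihi (by omega), ih (by omega)]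
    have hne : contextAt K (e * K + j) ≠ k := fun h => by
      have := contextAt_val (K := K) (e := e) (hj.trans k.2)
      rw [h] at this
      omega
    simp only [runColumns]
    rw [hact j le_rfl, ih hj]
    simp [swapAgents, hne]

theorem active_swapAgents (ω : Randomness N R K) (k : Fin K) (a b : Fin N) (e : ℕ)
    {j : ℕ} (hj : j ≤ k) :
    active (runColumns (swapAgents k a b ω) e) j = active (runColumns ω e) j := by
  induction j with
  | zero => rfl
  | succ j ih => rw [active, active, ih (by omega), runColumns_swapAgents_of_lt ω k a b e (by omega)]

theorem active_runColumns_succ_subset (ω : Randomness N R K) (e k : ℕ) :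
    active (runColumns ω (e + 1)) k ⊆ active (runColumns ω e) k :=
  active_subset_of_update (ξ := fun k => ω.2 (e * K + k)) (fun _ => rfl) k

/-- The update treats agents inside the active set symmetrically. Being active in episode e
suffices, since active sets only shrink and both agents were thus active in all earlier episodes. -/
theorem runColumns_swapAgents (ω : Randomness N R K) (k : Fin K) {a b : Fin N} (e : ℕ)
    (ha : a ∈ active (runColumns ω e) k) (hb : b ∈ active (runColumns ω e) k) :
    runColumns (swapAgents k a b ω) (e + 1) k =
      fun i => runColumns ω (e + 1) k (Equiv.swap a b i) := by
  have hstep : ∀ e, a ∈ active (runColumns ω e) k → b ∈ active (runColumns ω e) k →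
      runColumns (swapAgents k a b ω) e k = (fun i => runColumns ω e k (Equiv.swap a b i)) →
      runColumns (swapAgents k a b ω) (e + 1) k =
        fun i => runColumns ω (e + 1) k (Equiv.swap a b i) := by
    intro e ha hb h
    have hctx : contextAt K (e * K + k) = k := Fin.ext (contextAt_val k.2)
    simp only [runColumns]
    rw [active_swapAgents ω k a b e le_rfl, h]
    simp only [swapAgents, hctx, if_true]
    exact updateColumn_comp_perm (swap_mem_iff ha hb) _ _
  induction e with
  | zero =>
    refine hstep 0 ha hb ?_
    have hk : Fin.ofNat K (k : ℕ) = k := Fin.ext (Nat.mod_eq_of_lt k.2)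
    funext n
    simp only [runColumns, swapAgents, hk, if_true]
  | succ e ih =>
    exact hstep (e + 1) ha hb (ih (active_runColumns_succ_subset ω e k ha)
      (active_runColumns_succ_subset ω e k hb))

end Swap

end AllocationGame

/-! ### Exchangeability and the recursion for expected potentials -/

namespace AllocationGame

variable {N R K : ℕ}

theorem mul_lt_of_lt_servedContexts {k : ℕ} (hR : 0 < R) (hk : k < servedContexts N R K) :
    k * R < N := by
  have h1 : k < ⌈(N : ℝ) / R⌉₊ := hk.trans_le (min_le_right _ _)
  rw [Nat.lt_ceil, lt_div_iff₀ (by exact_mod_cast hR)] at h1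
  exact_mod_cast h1

/-- Before context k there are always at least R active agents, so each of these contexts removes
exactly R agents minus its holes. -/
theorem card_active_add {c : ℕ → Column N R} {k : ℕ} (hR : 0 < R)
    (hk : k < servedContexts N R K) :
    (active c k).card + k * R = N + ∑ i ∈ Finset.range k, holes (active c i) (c i) := by
  induction k with
  | zero => simp [active]
  | succ k ih =>
    have h1 := ih (by omega)
    have h2 := card_active_succ c k
    have h3 := card_winners_le (active c k) (c k)
    have h4 := mul_lt_of_lt_servedContexts hR hk
    have h5 := card_active_ge c k
    rw [Finset.sum_range_succ]
    rw [Nat.succ_mul] at h4 ⊢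
    unfold holes at h1 ⊢
    omega

/-- The importance of context `k` in the global potential function. -/
noncomputable def contextWeight (J k : ℕ) : ℝ := max 1 ((J : ℝ) - 1 - k)

theorem contextWeight_pos (J k : ℕ) : 0 < contextWeight J k :=
  lt_of_lt_of_le one_pos (le_max_left _ _)

/-- For weight 1 there are at most as many actions in use as agents. Otherwise there are at most R +
1 ≤ 2R actions, whereas (J-1)R < N leaves more than (J-1-k)R active agents, with J = `servedContexts
N R K`. -/
theorem card_image_mul_contextWeight_le {c : ℕ → Column N R} {k : ℕ} (hR : 0 < R)
    (hk : k < servedContexts N R K) (c' : Column N R) :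
    (((active c k).image c').card : ℝ) * contextWeight (servedContexts N R K) k ≤
      2 * (active c k).card := by
  have himg : ((active c k).image c').card ≤ (active c k).card := Finset.card_image_le
  have hn : (0 : ℝ) ≤ ((active c k).image c').card := Nat.cast_nonneg _
  rcases le_total ((servedContexts N R K : ℝ) - 1 - k) 1 with h | h
  · rw [contextWeight, max_eq_left h, mul_one]
    have : (((active c k).image c').card : ℝ) ≤ (active c k).card := by exact_mod_cast himg
    linarith [(Nat.cast_nonneg (active c k).card : (0 : ℝ) ≤ _)]
  · rw [contextWeight, max_eq_right h]
    have h1 : ((active c k).image c').card ≤ R + 1 :=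
      (Finset.card_le_univ _).trans (by simp)
    have h2 := card_active_ge c k
    have h3 := mul_lt_of_lt_servedContexts (N := N) (K := K) (k := servedContexts N R K - 1) hR
      (by omega)
    have h4 : ((servedContexts N R K - 1 : ℕ) : ℝ) = servedContexts N R K - 1 := by
      rw [Nat.cast_sub (by omega), Nat.cast_one]
    have h2' : (N : ℝ) ≤ (active c k).card + k * R := by exact_mod_cast h2
    have h3' : ((servedContexts N R K : ℝ) - 1) * R < N := by
      rw [← h4]; exact_mod_cast h3
    have h1' : (((active c k).image c').card : ℝ) ≤ 2 * R := by
      exact_mod_cast h1.trans (by omega : R + 1 ≤ 2 * R)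
    have h5 := mul_le_mul_of_nonneg_right h1' (by linarith : (0 : ℝ) ≤ servedContexts N R K - 1 - k)
    linarith

variable [NeZero R] [NeZero K]

section Exchangeability

variable (p : unitInterval)

/-- The swap preserves both active sets of context k, and hence who is leaving; only the column of
that context is relabelled. `hG` discards the runs where the symmetry fails. -/
theorem integral_swap (k : Fin K) (a b : Fin N) (e : ℕ)
    (G : Finset (Fin N) → Finset (Fin N) → Column N R → ℝ)
    (hG : ∀ A A' c, (a ∉ A ∨ b ∉ A) → G A A' c = 0) :
    ∫ ω, G (active (runColumns ω e) k) (active (runColumns ω (e + 1)) k)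
        (runColumns ω (e + 1) k) ∂(runLaw N R K p) =
      ∫ ω, G (active (runColumns ω e) k) (active (runColumns ω (e + 1)) k)
        (fun i => runColumns ω (e + 1) k (Equiv.swap a b i)) ∂(runLaw N R K p) := by
  have hmp := measurePreserving_swapAgents (N := N) (R := R) p k a b
  have hI := integrable_comp_of_finite (runLaw N R K p)
    ((measurable_active_runColumns e k).prodMk ((measurable_active_runColumns (e + 1) k).prodMk
      (measurable_runColumns (e + 1) k))) (fun q => G q.1 q.2.1 q.2.2)
  conv_lhs => rw [← hmp.map_eq]
  rw [integral_map hmp.measurable.aemeasurable (by rw [hmp.map_eq]; exact hI.1)]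
  refine integral_congr_ae (Filter.Eventually.of_forall fun ω => ?_)
  simp only [active_swapAgents ω k a b _ le_rfl]
  by_cases h : a ∈ active (runColumns ω e) k ∧ b ∈ active (runColumns ω e) k
  · rw [runColumns_swapAgents ω k e h.1 h.2]
  · rw [hG _ _ _ (by tauto), hG _ _ _ (by tauto)]

/-- Who leaves is decided in earlier contexts, so a leaving agent's action may be replaced by that
of a uniformly chosen active agent b. Summing load⁻¹ over all b counts the actions in use
(`sum_inv_load`). -/
theorem integral_sum_inv_load (k : Fin K) (e : ℕ) :
    ∫ ω, ∑ a ∈ active (runColumns ω e) k \ active (runColumns ω (e + 1)) k,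
        (load (active (runColumns ω e) k) (runColumns ω (e + 1) k)
          (runColumns ω (e + 1) k a) : ℝ)⁻¹ ∂(runLaw N R K p) =
      ∫ ω, ((active (runColumns ω e) k \ active (runColumns ω (e + 1)) k).card : ℝ) /
        (active (runColumns ω e) k).card *
        ((active (runColumns ω e) k).image (runColumns ω (e + 1) k)).card ∂(runLaw N R K p) := by
  -- Here a is leaving, b is a partner drawn uniformly from A, and x is the agent whose action is
  -- inspected; the swap turns x = a into x = b.
  let G : Fin N → Fin N → Fin N → Finset (Fin N) → Finset (Fin N) → Column N R → ℝ :=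
    fun a b x A A' c =>
      if a ∈ A \ A' ∧ b ∈ A then (load A c (c x) : ℝ)⁻¹ / A.card else 0
  have hmeas : ∀ F : Finset (Fin N) → Finset (Fin N) → Column N R → ℝ,
      Integrable (fun ω => F (active (runColumns ω e) k) (active (runColumns ω (e + 1)) k)
        (runColumns ω (e + 1) k)) (runLaw N R K p) := fun F =>
    integrable_comp_of_finite (runLaw N R K p)
    ((measurable_active_runColumns e k).prodMk ((measurable_active_runColumns (e + 1) k).prodMk
      (measurable_runColumns (e + 1) k))) (fun q => F q.1 q.2.1 q.2.2)
  have hL : ∀ (A A' : Finset (Fin N)) (c : Column N R),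
      ∑ a ∈ A \ A', (load A c (c a) : ℝ)⁻¹ = ∑ a, ∑ b, G a b a A A' c := by
    intro A A' c
    rw [← Finset.univ_inter (A \ A'), ← Finset.sum_ite_mem]
    refine Finset.sum_congr rfl fun a _ => ?_
    simp only [G]
    by_cases ha : a ∈ A \ A'
    · have hne : (A.card : ℝ) ≠ 0 := by
        exact_mod_cast (Finset.card_pos.2 ⟨a, (Finset.mem_sdiff.1 ha).1⟩).ne'
      simp only [ha, true_and, if_true, Finset.sum_ite_mem, Finset.univ_inter, Finset.sum_const,
        nsmul_eq_mul]
      field_simp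
    · simp [ha]
  have hRt : ∀ (A A' : Finset (Fin N)) (c : Column N R),
      ((A \ A').card : ℝ) / A.card * (A.image c).card = ∑ a, ∑ b, G a b b A A' c := by
    intro A A' c
    rw [← sum_inv_load, div_mul_eq_mul_div, mul_div_assoc, Finset.sum_div, ← nsmul_eq_mul,
      ← Finset.sum_const, ← Finset.univ_inter (A \ A'), ← Finset.sum_ite_mem]
    refine Finset.sum_congr rfl fun a _ => ?_
    simp only [G]
    by_cases ha : a ∈ A \ A'
    · simp only [ha, true_and, if_true, Finset.sum_ite_mem, Finset.univ_inter]
    · simp [ha]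
  simp only [hL, hRt]
  rw [integral_finsetSum _ fun a _ => hmeas fun A A' c => ∑ b, G a b a A A' c,
    integral_finsetSum _ fun a _ => hmeas fun A A' c => ∑ b, G a b b A A' c]
  refine Finset.sum_congr rfl fun a _ => ?_
  rw [integral_finsetSum _ fun b _ => hmeas fun A A' c => G a b a A A' c,
    integral_finsetSum _ fun b _ => hmeas fun A A' c => G a b b A A' c]
  refine Finset.sum_congr rfl fun b _ => ?_
  rw [integral_swap p k a b e (G a b a) ?_]
  · refine integral_congr_ae (Filter.Eventually.of_forall fun ω => ?_)
    simp only [G]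
    refine if_ctx_congr Iff.rfl (fun h => ?_) fun _ => rfl
    rw [load_comp_perm (swap_mem_iff (Finset.mem_sdiff.1 h.1).1 h.2), Equiv.swap_apply_left]
  · intro A A' c h
    simp only [G]
    rw [if_neg]
    rintro ⟨h1, h2⟩
    exact h.elim (fun h => h (Finset.mem_sdiff.1 h1).1) fun h => h h2

end Exchangeability

section Means

variable (N R K)

/-- The expected number of missing successes in context `k` of episode `e`. -/
noncomputable def meanHoles (p : unitInterval) (k e : ℕ) : ℝ :=
  ∫ ω, (holes (active (runColumns ω e) k) (runColumns ω e k) : ℝ) ∂(runLaw N R K p)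

/-- The expected potential of context `k` in episode `e`. -/
noncomputable def meanPotential (p : unitInterval) (k e : ℕ) : ℝ :=
  ∫ ω, potential (successRate p) (active (runColumns ω e) k) (runColumns ω e k) ∂(runLaw N R K p)

variable {N R K} {p : unitInterval}

theorem integrable_column (p : unitInterval) (k e : ℕ) (F : Finset (Fin N) → Column N R → ℝ) :
    Integrable (fun ω => F (active (runColumns ω e) k) (runColumns ω e k)) (runLaw N R K p) :=
  integrable_comp_of_finite (runLaw N R K p)
    ((measurable_active_runColumns e k).prodMk (measurable_runColumns e k)) fun q => F q.1 q.2

theorem meanHoles_nonneg (k e : ℕ) : 0 ≤ meanHoles N R K p k e :=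
  integral_nonneg fun _ => Nat.cast_nonneg _

theorem meanHoles_le (k e : ℕ) : meanHoles N R K p k e ≤ min R N := by
  refine (integral_mono (g := fun _ => ((min R N : ℕ) : ℝ))
    (integrable_column p k e fun A c => (holes A c : ℝ)) (integrable_const _) fun ω => ?_).trans ?_
  · have h1 : (active (runColumns ω e) k).card ≤ N := (Finset.card_le_univ _).trans (by simp)
    have h2 : holes (active (runColumns ω e) k) (runColumns ω e k) ≤ min R N := by
      unfold holes; omega
    exact Nat.cast_le.2 h2
  · simp

theorem meanHoles_le_two_mul (hp0 : 0 < (p : ℝ)) (hp1 : (p : ℝ) < 1) (k e : ℕ) :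
    meanHoles N R K p k e ≤ 2 * meanPotential N R K p k e := by
  rw [meanPotential, ← integral_const_mul]
  exact integral_mono (integrable_column p k e fun A c => (holes A c : ℝ))
    (integrable_column p k e fun A c => 2 * potential (successRate p) A c)
    fun ω => holes_le_two_mul_potential (successRate_pos hp1).le (successRate_le_one hp0.le hp1) _ _

theorem meanPotential_le_two_mul (hp0 : 0 < (p : ℝ)) (hp1 : (p : ℝ) < 1) (k e : ℕ) :
    meanPotential N R K p k e ≤ 2 * meanHoles N R K p k e := by
  rw [meanHoles, ← integral_const_mul]
  exact integral_mono (integrable_column p k e fun A c => potential (successRate p) A c)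
    (integrable_column p k e fun A c => 2 * (holes A c : ℝ))
    fun ω => potential_le_two_mul_holes (successRate_pos hp1).le (successRate_le_one hp0.le hp1) _ _

/-- By the balance `card_active_add` in both episodes, the active set of context k shrinks by
exactly the net number of holes closed before k. -/
theorem integral_card_leaving (e : ℕ) {k : ℕ} (hk : k < servedContexts N R K) :
    ∫ ω, ((active (runColumns ω e) k \ active (runColumns ω (e + 1)) k).card : ℝ)
      ∂(runLaw N R K p) =
      ∑ i ∈ Finset.range k, (meanHoles N R K p i e - meanHoles N R K p i (e + 1)) := by
  have hR := Nat.pos_of_ne_zero (NeZero.ne R)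
  have hpoint : ∀ ω : Randomness N R K,
      ((active (runColumns ω e) k \ active (runColumns ω (e + 1)) k).card : ℝ) =
      ∑ i ∈ Finset.range k, ((holes (active (runColumns ω e) i) (runColumns ω e i) : ℝ) -
        holes (active (runColumns ω (e + 1)) i) (runColumns ω (e + 1) i)) := by
    intro ω
    have h1 := card_active_add (c := runColumns ω e) hR hk
    have h2 := card_active_add (c := runColumns ω (e + 1)) hR hk
    have h3 := Finset.card_sdiff_add_card_eq_card (active_runColumns_succ_subset ω e k)
    rw [Finset.sum_sub_distrib, ← Nat.cast_sum, ← Nat.cast_sum, eq_sub_iff_add_eq]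
    norm_cast
    omega
  simp only [hpoint]
  rw [integral_finsetSum]
  · refine Finset.sum_congr rfl fun i _ => ?_
    rw [integral_sub (integrable_column p i e fun A c => (holes A c : ℝ))
      (integrable_column p i (e + 1) fun A c => (holes A c : ℝ))]
    rfl
  · exact fun i _ => (integrable_column p i e fun A c => (holes A c : ℝ)).sub
      (integrable_column p i (e + 1) fun A c => (holes A c : ℝ))

/-- An episode is split in two: the update with the active set of episode e, which contracts, and
then the departures, whose cost is bounded through exchangeability. -/
theorem meanPotential_succ_le (hp0 : 0 < (p : ℝ)) (hp1 : (p : ℝ) < 1) {ρ : ℝ}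
    (hρ1 : ρ ≤ successRate p / (16 * R))
    (hρ2 : 2 ≤ N → ρ ≤ successRate p * p / (16 * R))
    (hρ3 : 2 ≤ N → ρ ≤ successRate p * p / (4 * Real.log N)) (hρ : 0 ≤ ρ) (e : ℕ) {k : ℕ}
    (hk : k < servedContexts N R K) :
    meanPotential N R K p k (e + 1) ≤ (1 - ρ) * meanPotential N R K p k e +
      4 / contextWeight (servedContexts N R K) k *
        ∑ i ∈ Finset.range k, (meanHoles N R K p i e - meanHoles N R K p i (e + 1)) := by
  have hR := Nat.pos_of_ne_zero (NeZero.ne R)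
  have hkK : k < K := hk.trans_le (min_le_left _ _)
  have hα0 := (successRate_pos hp1).le
  have hα1 := successRate_le_one hp0.le hp1
  have hw := contextWeight_pos (servedContexts N R K) k
  have hmeas : ∀ F : Finset (Fin N) → Finset (Fin N) → Column N R → ℝ,
      Integrable (fun ω => F (active (runColumns ω e) k) (active (runColumns ω (e + 1)) k)
        (runColumns ω (e + 1) k)) (runLaw N R K p) := fun F =>
    integrable_comp_of_finite (runLaw N R K p)
    ((measurable_active_runColumns e k).prodMk ((measurable_active_runColumns (e + 1) k).prodMk
      (measurable_runColumns (e + 1) k))) (fun q => F q.1 q.2.1 q.2.2)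
  have h1 : meanPotential N R K p k (e + 1) ≤
      ∫ ω, potential (successRate p) (active (runColumns ω e) k) (runColumns ω (e + 1) k)
        ∂(runLaw N R K p) +
      2 * ∫ ω, ∑ a ∈ active (runColumns ω e) k \ active (runColumns ω (e + 1)) k,
        (load (active (runColumns ω e) k) (runColumns ω (e + 1) k)
          (runColumns ω (e + 1) k a) : ℝ)⁻¹ ∂(runLaw N R K p) := by
    rw [← integral_const_mul, ← integral_add (hmeas fun A _ c => potential (successRate p) A c)
      (hmeas fun A A' c => 2 * ∑ a ∈ A \ A', (load A c (c a) : ℝ)⁻¹)]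
    exact integral_mono (hmeas fun _ A' c => potential (successRate p) A' c)
      (hmeas fun A A' c => potential (successRate p) A c +
        2 * ∑ a ∈ A \ A', (load A c (c a) : ℝ)⁻¹)
      fun ω => potential_le_of_subset hα0 hα1 (active_runColumns_succ_subset ω e k) _
  have h2 : ∫ ω, potential (successRate p) (active (runColumns ω e) k) (runColumns ω (e + 1) k)
        ∂(runLaw N R K p) ≤ (1 - ρ) * meanPotential N R K p k e := by
    rw [integral_runColumns_succ p hkK (potential (successRate p)), meanPotential,
      ← integral_const_mul]
    exact integral_mono
      (integrable_column p k e fun A c => ∫ ξ, potential (successRate p) A (updateColumn A ξ c)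
        ∂(coinLaw N R p))
      (integrable_column p k e fun A c => (1 - ρ) * potential (successRate p) A c)
      fun ω => integral_potential_update_le hp0 hp1 _ _ hρ1 hρ2 hρ3 hρ
  have h3 : ∫ ω, ∑ a ∈ active (runColumns ω e) k \ active (runColumns ω (e + 1)) k,
        (load (active (runColumns ω e) k) (runColumns ω (e + 1) k)
          (runColumns ω (e + 1) k a) : ℝ)⁻¹ ∂(runLaw N R K p) ≤
      2 / contextWeight (servedContexts N R K) k *
        ∑ i ∈ Finset.range k, (meanHoles N R K p i e - meanHoles N R K p i (e + 1)) := by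
    rw [integral_sum_inv_load p ⟨k, hkK⟩ e, ← integral_card_leaving e hk, ← integral_const_mul]
    refine integral_mono (hmeas fun A A' c => ((A \ A').card : ℝ) / A.card * (A.image c).card)
      (hmeas fun A A' c => 2 / contextWeight (servedContexts N R K) k * ((A \ A').card : ℝ))
      fun ω => ?_
    have h4 := card_image_mul_contextWeight_le (c := runColumns ω e) (K := K) hR hk
      (runColumns ω (e + 1) k)
    simp only
    rcases Nat.eq_zero_or_pos (active (runColumns ω e) k).card with h0 | h0
    · rw [h0]
      simp only [Nat.cast_zero, div_zero, zero_mul]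
      positivity
    · have h0' : (0 : ℝ) < (active (runColumns ω e) k).card := by exact_mod_cast h0
      rw [div_mul_eq_mul_div, div_mul_eq_mul_div, div_le_div_iff₀ h0' hw]
      have h5 : (0 : ℝ) ≤ (active (runColumns ω e) k \ active (runColumns ω (e + 1)) k).card :=
        Nat.cast_nonneg _
      have h6 := mul_le_mul_of_nonneg_left h4 h5
      linarith
  have h7 : 4 / contextWeight (servedContexts N R K) k =
      2 * (2 / contextWeight (servedContexts N R K) k) := by ring
  rw [h7, mul_assoc]
  linarith

end Means

/-! ### Decay of the cascade over all contexts -/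

theorem sum_sum_range_lt (x : ℕ → ℝ) (J : ℕ) :
    ∑ k ∈ Finset.range J, ∑ i ∈ Finset.range k, x i =
      ∑ i ∈ Finset.range J, ((J : ℝ) - 1 - i) * x i := by
  induction J with
  | zero => simp
  | succ J ih =>
    rw [Finset.sum_range_succ, ih, Finset.sum_range_succ, ← Finset.sum_add_distrib]
    push_cast
    rw [show (J : ℝ) + 1 - 1 - J = 0 by ring, zero_mul, add_zero]
    exact Finset.sum_congr rfl fun i _ => by ring

/-- Geometric decay of a cascade: what is lost in a context is caused by earlier contexts. -/
theorem cascade_decay {J : ℕ} {u d : ℕ → ℕ → ℝ} {ρ M : ℝ} (hρ : 0 ≤ ρ) (hρ1 : ρ ≤ 1)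
    (hd : ∀ k e, 0 ≤ d k e) (hdu : ∀ k e, d k e ≤ 2 * u k e) (hud : ∀ k e, u k e ≤ 2 * d k e)
    (hM : ∀ k, d k 0 ≤ M)
    (hrec : ∀ e, ∀ k < J, u k (e + 1) ≤ (1 - ρ) * u k e +
      4 / contextWeight J k * ∑ i ∈ Finset.range k, (d i e - d i (e + 1))) (e : ℕ) :
    ∑ k ∈ Finset.range J, d k e ≤ 12 * J ^ 2 * M * (1 - ρ / 9) ^ e := by
  -- The second summand prepays the disturbances: closing a hole in context k costs at most 4, after
  -- weighting, in each of the J-1-k later contexts.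
  let Z : ℕ → ℝ := fun e =>
    ∑ k ∈ Finset.range J, (contextWeight J k * u k e + 4 * ((J : ℝ) - 1 - k) * d k e)
  have hu : ∀ k e, 0 ≤ u k e := fun k e => by linarith [hd k e, hdu k e]
  have hcoef : ∀ k ∈ Finset.range J, 0 ≤ (J : ℝ) - 1 - k := by
    intro k hk
    have : ((k + 1 : ℕ) : ℝ) ≤ J := by exact_mod_cast Finset.mem_range.1 hk
    push_cast at this
    linarith
  have hM0 : 0 ≤ M := (hd 0 0).trans (hM 0)
  -- Since d ≤ 2u, the prepayment is at most 8 times the first summand. Only the first summand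
  -- contracts by ρ, so Z contracts by ρ/9.
  have hZ9 : ∀ e, Z e ≤ 9 * ∑ k ∈ Finset.range J, contextWeight J k * u k e := by
    intro e
    rw [Finset.mul_sum]
    refine Finset.sum_le_sum fun k hk => ?_
    have h1 : ((J : ℝ) - 1 - k) * d k e ≤ contextWeight J k * (2 * u k e) :=
      mul_le_mul (le_max_right _ _) (hdu k e) (hd k e) (contextWeight_pos J k).le
    linarith
  have hstep : ∀ e, Z (e + 1) ≤ (1 - ρ / 9) * Z e := by
    intro e
    have h1 : ∑ k ∈ Finset.range J, contextWeight J k * u k (e + 1) ≤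
        (1 - ρ) * ∑ k ∈ Finset.range J, contextWeight J k * u k e +
        4 * ∑ k ∈ Finset.range J, ((J : ℝ) - 1 - k) * (d k e - d k (e + 1)) := by
      rw [← sum_sum_range_lt, Finset.mul_sum, Finset.mul_sum, ← Finset.sum_add_distrib]
      refine Finset.sum_le_sum fun k hk => ?_
      have h2 := mul_le_mul_of_nonneg_left (hrec e k (Finset.mem_range.1 hk))
        (contextWeight_pos J k).le
      have h3 : contextWeight J k * ((1 - ρ) * u k e +
          4 / contextWeight J k * ∑ i ∈ Finset.range k, (d i e - d i (e + 1))) =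
          (1 - ρ) * (contextWeight J k * u k e) +
          4 * ∑ i ∈ Finset.range k, (d i e - d i (e + 1)) := by
        have := (contextWeight_pos J k).ne'
        field_simp
      linarith
    have h4 : ∑ k ∈ Finset.range J, ((J : ℝ) - 1 - k) * (d k e - d k (e + 1)) =
        ∑ k ∈ Finset.range J, ((J : ℝ) - 1 - k) * d k e -
        ∑ k ∈ Finset.range J, ((J : ℝ) - 1 - k) * d k (e + 1) := by
      rw [← Finset.sum_sub_distrib]
      exact Finset.sum_congr rfl fun k _ => by ring
    have hZ : ∀ e, Z e = ∑ k ∈ Finset.range J, contextWeight J k * u k e +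
        4 * ∑ k ∈ Finset.range J, ((J : ℝ) - 1 - k) * d k e := by
      intro e
      rw [Finset.mul_sum, ← Finset.sum_add_distrib]
      exact Finset.sum_congr rfl fun k _ => by ring
    have h5 := mul_le_mul_of_nonneg_left (hZ9 e) hρ
    rw [h4] at h1
    have h6 := hZ e
    have h7 := hZ (e + 1)
    linarith
  have hpow : ∀ e, Z e ≤ (1 - ρ / 9) ^ e * Z 0 := by
    intro e
    induction e with
    | zero => simp
    | succ e ih =>
      rw [pow_succ', mul_assoc]
      exact (hstep e).trans (mul_le_mul_of_nonneg_left ih (by linarith))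
  have hZ0 : Z 0 ≤ 6 * J ^ 2 * M := by
    have h1 : ∀ k ∈ Finset.range J, contextWeight J k * u k 0 + 4 * ((J : ℝ) - 1 - k) * d k 0 ≤
        6 * J * M := by
      intro k hk
      have hJ : (1 : ℝ) ≤ J := by
        exact_mod_cast (Nat.zero_le k).trans_lt (Finset.mem_range.1 hk)
      have hk0 : (0 : ℝ) ≤ k := Nat.cast_nonneg k
      have h2 : contextWeight J k ≤ J := max_le hJ (by linarith)
      have h3 : contextWeight J k * u k 0 ≤ J * (2 * M) :=
        mul_le_mul h2 (by linarith [hud k 0, hM k]) (hu k 0) (by linarith)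
      have h4 : ((J : ℝ) - 1 - k) * d k 0 ≤ J * M :=
        mul_le_mul (by linarith) (hM k) (hd k 0) (by linarith)
      linarith
    refine (Finset.sum_le_sum h1).trans (le_of_eq ?_)
    rw [Finset.sum_const, Finset.card_range, nsmul_eq_mul]
    ring
  have hlow : ∑ k ∈ Finset.range J, d k e ≤ 2 * Z e := by
    rw [Finset.mul_sum]
    refine Finset.sum_le_sum fun k hk => ?_
    have h1 : 1 * u k e ≤ contextWeight J k * u k e :=
      mul_le_mul_of_nonneg_right (le_max_left _ _) (hu k e)
    have h2 := mul_nonneg (hcoef k hk) (hd k e)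
    linarith [hdu k e]
  have hpos : 0 ≤ (1 - ρ / 9) ^ e := pow_nonneg (by linarith) e
  have h8 := mul_le_mul_of_nonneg_left hZ0 hpos
  linarith [hpow e]

end AllocationGame

/-! ### From decay to the expected convergence time -/

namespace AllocationGame

variable {N R K : ℕ} [NeZero R] [NeZero K] {p : unitInterval}

/-- The runs in which some success is still missing in episode `e`. -/
def unsettledRuns (N R K : ℕ) [NeZero K] (e : ℕ) : Set (Randomness N R K) :=
  {ω | ∃ k < servedContexts N R K,
    holes (active (runColumns ω e) k) (runColumns ω e k) ≠ 0}

omit [NeZero R] in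
theorem measurableSet_unsettledRuns (e : ℕ) : MeasurableSet (unsettledRuns N R K e) := by
  have : unsettledRuns N R K e = ⋃ k ∈ Finset.range (servedContexts N R K),
      (fun ω => (active (runColumns ω e) k, runColumns ω e k)) ⁻¹' {q | holes q.1 q.2 ≠ 0} := by
    ext ω
    simp [unsettledRuns]
  rw [this]
  exact Finset.measurableSet_biUnion _ fun k _ =>
    ((measurable_active_runColumns e k).prodMk (measurable_runColumns e k)) (.of_discrete)

/-- Markov's inequality with a union bound: an unsettled run has at least one hole. -/
theorem measure_unsettledRuns_le (e : ℕ) :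
    runLaw N R K p (unsettledRuns N R K e) ≤
      ENNReal.ofReal (∑ k ∈ Finset.range (servedContexts N R K), meanHoles N R K p k e) := by
  rw [← ofReal_measureReal, ← integral_indicator_one (measurableSet_unsettledRuns e)]
  refine ENNReal.ofReal_le_ofReal ?_
  simp only [meanHoles]
  have hint : ∀ k, Integrable (fun ω : Randomness N R K =>
      (holes (active (runColumns ω e) k) (runColumns ω e k) : ℝ)) (runLaw N R K p) :=
    fun k => integrable_column p k e fun A c => (holes A c : ℝ)
  rw [← integral_finsetSum _ fun k _ => hint k]
  refine integral_mono ((integrable_const 1).indicator (measurableSet_unsettledRuns e))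
    (integrable_finsetSum _ fun k _ => hint k) fun ω => ?_
  by_cases h : ω ∈ unsettledRuns N R K e
  · rw [Set.indicator_of_mem h]
    obtain ⟨k, hk, hne⟩ := h
    refine le_trans ?_ (Finset.single_le_sum (f := fun k =>
      (holes (active (runColumns ω e) k) (runColumns ω e k) : ℝ))
      (fun k _ => Nat.cast_nonneg _) (Finset.mem_range.2 hk))
    exact Nat.one_le_cast.2 (Nat.pos_of_ne_zero hne)
  · rw [Set.indicator_of_notMem h]
    exact Finset.sum_nonneg fun k _ => Nat.cast_nonneg _

/-- Up to the first settled episode each episode contributes its K time-steps. A run that never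
settles makes the right side infinite, so almost sure convergence needs no separate argument. -/
theorem convergenceTime_le_tsum {ζ : ℝ} (hζ : ζ < 0) (ω : Randomness N R K) :
    convergenceTime ζ ω ≤
      ∑' e, (unsettledRuns N R K e).indicator (fun _ => (K : ℝ≥0∞)) ω := by
  classical
  by_cases h : ∃ e, ω ∉ unsettledRuns N R K e
  · have hspec := Nat.find_spec h
    have hmin : ∀ e < Nat.find h, ω ∈ unsettledRuns N R K e :=
      fun e he => not_not.1 (Nat.find_min h he)
    refine (convergenceTime_le_of_holes hζ (e := Nat.find h) fun k hk => ?_).trans ?_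
    · by_contra hne
      exact hspec ⟨k, hk, hne⟩
    · refine le_trans (le_of_eq ?_) (ENNReal.sum_le_tsum (Finset.range (Nat.find h)))
      rw [Finset.sum_congr rfl fun e he =>
        Set.indicator_of_mem (hmin e (Finset.mem_range.1 he)) _]
      simp
  · push Not at h
    have hK : (K : ℝ≥0∞) ≠ 0 := by exact_mod_cast NeZero.ne K
    simp [Set.indicator_of_mem (h _), ENNReal.tsum_const_eq_top_of_ne_zero hK]

/-- The first ⌈log B / r⌉ terms are bounded by 1; from there on B has been used up and a plain
geometric series remains. Thus B enters only through its logarithm. -/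
theorem tsum_min_one_geometric_le {B r : ℝ} (hB : 1 ≤ B) (hr : 0 < r) (hr1 : r ≤ 1) :
    ∑' e : ℕ, min 1 (ENNReal.ofReal (B * (1 - r) ^ e)) ≤
      ENNReal.ofReal (Real.log B / r + 1 + 1 / r) := by
  set M := ⌈Real.log B / r⌉₊ with hM
  have hlog : 0 ≤ Real.log B := Real.log_nonneg hB
  have hMle : (M : ℝ) ≤ Real.log B / r + 1 := (Nat.ceil_lt_add_one (by positivity)).le
  have hBM : B * (1 - r) ^ M ≤ 1 := by
    have h1 : (1 - r) ^ M ≤ Real.exp (-r) ^ M :=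
      pow_le_pow_left₀ (by linarith) (Real.one_sub_le_exp_neg r) M
    have h2 : Real.exp (-r) ^ M ≤ B⁻¹ := by
      rw [← Real.exp_nat_mul, ← Real.exp_log (by positivity : 0 < B⁻¹), Real.exp_le_exp,
        Real.log_inv]
      have := Nat.le_ceil (Real.log B / r)
      rw [← hM, div_le_iff₀ hr] at this
      linarith
    calc B * (1 - r) ^ M ≤ B * B⁻¹ := by gcongr; exact h1.trans h2
      _ = 1 := mul_inv_cancel₀ (by positivity)
  have hsplit := (ENNReal.summable (f := fun e =>
    min 1 (ENNReal.ofReal (B * (1 - r) ^ (e + M))))).sum_add_tsum_nat_add'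
    (f := fun e => min 1 (ENNReal.ofReal (B * (1 - r) ^ e)))
  rw [← hsplit]
  have h1 : ∑ e ∈ Finset.range M, min 1 (ENNReal.ofReal (B * (1 - r) ^ e)) ≤
      ENNReal.ofReal (Real.log B / r + 1) := by
    refine (Finset.sum_le_sum (g := fun _ => 1) fun e _ => min_le_left _ _).trans ?_
    rw [Finset.sum_const, Finset.card_range, nsmul_eq_mul, mul_one, ← ENNReal.ofReal_natCast]
    exact ENNReal.ofReal_le_ofReal hMle
  have h2 : ∑' e : ℕ, min 1 (ENNReal.ofReal (B * (1 - r) ^ (e + M))) ≤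
      ENNReal.ofReal (1 / r) := by
    have h3 : ∑' e : ℕ, ENNReal.ofReal ((1 - r) ^ e) = ENNReal.ofReal (1 / r) := by
      rw [← ENNReal.ofReal_tsum_of_nonneg (fun e => pow_nonneg (by linarith) e)
        (summable_geometric_of_lt_one (by linarith) (by linarith)),
        tsum_geometric_of_lt_one (by linarith) (by linarith)]
      congr 1
      rw [sub_sub_cancel, one_div]
    rw [← h3]
    refine ENNReal.tsum_le_tsum fun e => (min_le_right _ _).trans (ENNReal.ofReal_le_ofReal ?_)
    have h4 : (0 : ℝ) ≤ (1 - r) ^ e := pow_nonneg (by linarith) e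
    calc B * (1 - r) ^ (e + M) = (B * (1 - r) ^ M) * (1 - r) ^ e := by rw [pow_add]; ring
      _ ≤ 1 * (1 - r) ^ e := mul_le_mul_of_nonneg_right hBM h4
      _ = _ := one_mul _
  refine (add_le_add h1 h2).trans (le_of_eq ?_)
  rw [← ENNReal.ofReal_add (by positivity) (by positivity)]

theorem expectedSteps_le_of_rate {ζ : ℝ} (hζ : ζ < 0) (hN : 1 ≤ N) (hp0 : 0 < (p : ℝ))
    (hp1 : (p : ℝ) < 1) {ρ : ℝ} (hρ : 0 < ρ) (hρ1 : ρ ≤ successRate p / (16 * R))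
    (hρ2 : 2 ≤ N → ρ ≤ successRate p * p / (16 * R))
    (hρ3 : 2 ≤ N → ρ ≤ successRate p * p / (4 * Real.log N)) :
    expectedSteps N R K p ζ ≤ ENNReal.ofReal
      (9 * K / ρ * (5 + 2 * Real.log K + Real.log (min R N : ℕ))) := by
  have hRpos : 0 < R := Nat.pos_of_ne_zero (NeZero.ne R)
  have hR1 : (1 : ℝ) ≤ R := by exact_mod_cast hRpos
  have hK1 : (1 : ℝ) ≤ K := by exact_mod_cast Nat.pos_of_ne_zero (NeZero.ne K)
  have hm1 : (1 : ℝ) ≤ (min R N : ℕ) := by exact_mod_cast (by omega : 1 ≤ min R N)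
  have hρle : ρ ≤ 1 := by
    refine hρ1.trans ?_
    rw [div_le_one (by positivity)]
    linarith [successRate_le_one hp0.le hp1]
  set m : ℝ := ((min R N : ℕ) : ℝ) with hm
  set B : ℝ := 12 * (K : ℝ) ^ 2 * m with hBdef
  have hB1 : 1 ≤ B := by
    have : (1 : ℝ) ≤ (K : ℝ) ^ 2 := one_le_pow₀ hK1
    nlinarith
  have hprob : ∀ e, runLaw N R K p (unsettledRuns N R K e) ≤
      min 1 (ENNReal.ofReal (B * (1 - ρ / 9) ^ e)) := by
    intro e
    refine le_min prob_le_one ((measure_unsettledRuns_le e).trans (ENNReal.ofReal_le_ofReal ?_))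
    refine (cascade_decay (u := meanPotential N R K p) (M := m) hρ.le hρle
      (fun k e => meanHoles_nonneg k e) (meanHoles_le_two_mul hp0 hp1)
      (meanPotential_le_two_mul hp0 hp1) (fun k => ?_)
      (fun e k hk => meanPotential_succ_le hp0 hp1 hρ1 hρ2 hρ3 hρ.le e hk) e).trans ?_
    · refine (meanHoles_le k 0).trans (le_of_eq ?_)
      simp [hm]
    · have hJ : (servedContexts N R K : ℝ) ≤ K := by
        exact_mod_cast (min_le_left _ _ : servedContexts N R K ≤ K)
      have : 0 ≤ (1 - ρ / 9) ^ e := pow_nonneg (by linarith) e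
      have h0 : 0 ≤ m := by linarith
      rw [hBdef]
      gcongr
  have hlog : Real.log B ≤ 3 + 2 * Real.log K + Real.log m := by
    rw [hBdef, Real.log_mul (by positivity) (by positivity),
      Real.log_mul (by norm_num) (by positivity), Real.log_pow]
    have h12 : Real.log 12 ≤ 3 := by
      rw [Real.log_le_iff_le_exp (by norm_num)]
      have h := Real.exp_one_gt_d9
      have h3 : Real.exp 3 = Real.exp 1 ^ 3 := by rw [← Real.exp_nat_mul]; norm_num
      rw [h3]
      calc (12 : ℝ) ≤ 2.7 ^ 3 := by norm_num
        _ ≤ Real.exp 1 ^ 3 := by gcongr; linarith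
    push_cast
    linarith
  calc expectedSteps N R K p ζ
      ≤ ∫⁻ ω, ∑' e, (unsettledRuns N R K e).indicator (fun _ => (K : ℝ≥0∞)) ω
          ∂(runLaw N R K p) := lintegral_mono fun ω => convergenceTime_le_tsum hζ ω
    _ = ∑' e, K * runLaw N R K p (unsettledRuns N R K e) := by
        rw [lintegral_tsum fun e =>
          (measurable_const.indicator (measurableSet_unsettledRuns e)).aemeasurable]
        simp only [lintegral_indicator_const (measurableSet_unsettledRuns _)]
    _ ≤ K * ENNReal.ofReal (Real.log B / (ρ / 9) + 1 + 1 / (ρ / 9)) := by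
        rw [ENNReal.tsum_mul_left]
        gcongr
        exact (ENNReal.tsum_le_tsum hprob).trans
          (tsum_min_one_geometric_le hB1 (by positivity) (by linarith))
    _ ≤ _ := by
        rw [← ENNReal.ofReal_natCast, ← ENNReal.ofReal_mul (by positivity)]
        refine ENNReal.ofReal_le_ofReal ?_
        have h1 : Real.log B / (ρ / 9) + 1 + 1 / (ρ / 9) ≤
            9 / ρ * (5 + 2 * Real.log K + Real.log m) := by
          have h2 : 1 ≤ 9 / ρ := by rw [le_div_iff₀ hρ]; linarith
          have h3 : Real.log B / (ρ / 9) = 9 / ρ * Real.log B := by field_simp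
          have h4 : 1 / (ρ / 9) = 9 / ρ := by field_simp
          have h5 := mul_le_mul_of_nonneg_left hlog (by positivity : 0 ≤ 9 / ρ)
          rw [h3, h4]
          linarith
        calc (K : ℝ) * (Real.log B / (ρ / 9) + 1 + 1 / (ρ / 9))
            ≤ K * (9 / ρ * (5 + 2 * Real.log K + Real.log m)) := by gcongr
          _ = _ := by ring

/-- The number of episodes in which a single context makes substantial progress. -/
noncomputable def contextTime (N R : ℕ) (p : ℝ) : ℝ :=
  R + if 2 ≤ N then 1 / p * (R + Real.log N) else 0

theorem expectedSteps_le {ζ : ℝ} (hζ : ζ < 0) (hN : 1 ≤ N) (hp0 : 0 < (p : ℝ))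
    (hp1 : (p : ℝ) < 1) :
    expectedSteps N R K p ζ ≤ ENNReal.ofReal
      (720 * K * (1 + Real.log K) * (1 + Real.log (min R N : ℕ)) *
        ((2 - p) / (2 * (1 - p))) * contextTime N R p) := by
  have hR1 : (1 : ℝ) ≤ R := by exact_mod_cast Nat.pos_of_ne_zero (NeZero.ne R)
  have hα := successRate_pos hp1
  have hS : (R : ℝ) ≤ contextTime N R p := by
    unfold contextTime
    split_ifs
    · have : 0 ≤ 1 / (p : ℝ) * (R + Real.log N) :=
        mul_nonneg (by positivity) (add_nonneg (by linarith) (Real.log_natCast_nonneg N))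
      linarith
    · simp
  have hSpos : 0 < contextTime N R p := by linarith
  have hS2 : 2 ≤ N → R + Real.log N ≤ p * contextTime N R p := by
    intro h
    rw [contextTime, if_pos h, mul_add, ← mul_assoc, mul_one_div_cancel hp0.ne', one_mul]
    have : 0 ≤ (p : ℝ) * R := by positivity
    linarith
  set S := contextTime N R p with hSdef
  have hlogN := Real.log_natCast_nonneg N
  -- The rate is fixed by S ≥ R and, when N ≥ 2, by p * S ≥ R + log N. For N = 1 no 1/p may appear
  -- in S, as log N = 0 removes it from the target bound.
  refine (expectedSteps_le_of_rate hζ hN hp0 hp1 (ρ := successRate p / (16 * S))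
    (by positivity) (by gcongr) (fun h => ?_) fun h => ?_).trans (ENNReal.ofReal_le_ofReal ?_)
  · have := hS2 h
    rw [div_le_div_iff₀ (by positivity) (by positivity)]
    have h2 : 16 * (R : ℝ) ≤ p * (16 * S) := by linarith
    have := mul_le_mul_of_nonneg_left h2 hα.le
    linarith
  · have := hS2 h
    have hlog : 0 < Real.log N := Real.log_pos (by exact_mod_cast h)
    rw [div_le_div_iff₀ (by positivity) (by positivity)]
    have h2 : 4 * Real.log N ≤ p * (16 * S) := by linarith
    have := mul_le_mul_of_nonneg_left h2 hα.le
    linarith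
  · have hlogK := Real.log_natCast_nonneg K
    have hlogm := Real.log_natCast_nonneg (min R N)
    have hinv : 9 * K / (successRate p / (16 * S)) =
        144 * K * ((2 - p) / (2 * (1 - p))) * S := by
      have h1 : (1 : ℝ) - p ≠ 0 := by linarith
      have h2 : (2 : ℝ) - p ≠ 0 := by linarith
      rw [successRate]
      field_simp
      ring
    rw [hinv]
    have h3 : 5 + 2 * Real.log K + Real.log (min R N : ℕ) ≤
        5 * ((1 + Real.log K) * (1 + Real.log (min R N : ℕ))) := by
      nlinarith [mul_nonneg hlogK hlogm]
    have h4 : 0 ≤ 144 * K * ((2 - (p : ℝ)) / (2 * (1 - p))) * S := by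
      have : 0 ≤ (2 - (p : ℝ)) / (2 * (1 - p)) :=
        div_nonneg (by linarith) (by linarith)
      positivity
    have := mul_le_mul_of_nonneg_left h3 h4
    linarith

theorem one_add_log_natCast_le {n : ℕ} (hn : 1 ≤ n) : 1 + Real.log n ≤ n := by
  have := Real.log_le_sub_one_of_pos (by exact_mod_cast hn : (0 : ℝ) < n)
  linarith

omit [NeZero R] in
-- The factor 1 + log min(R,N) is absorbed by R in the terms R and (log N)/q, and by 3 log N in the
-- term R/q.
theorem contextTime_mul_le (hN : 1 ≤ N) (hR : 1 ≤ R) {q : ℝ} (hq : 0 < q) :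
    (1 + Real.log (min R N : ℕ)) * contextTime N R q ≤
      4 * (R * (1 / q * Real.log N + R)) := by
  have hm : 1 ≤ min R N := by omega
  have hR1 : (1 : ℝ) ≤ R := by exact_mod_cast hR
  have hlogm := Real.log_natCast_nonneg (min R N)
  have hlogR : 1 + Real.log (min R N : ℕ) ≤ R :=
    (one_add_log_natCast_le hm).trans (by exact_mod_cast min_le_left R N)
  have hlogN : Real.log (min R N : ℕ) ≤ Real.log N :=
    Real.log_le_log (by exact_mod_cast hm) (by exact_mod_cast min_le_right R N)
  have h1 : (1 + Real.log (min R N : ℕ)) * R ≤ R * R :=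
    mul_le_mul_of_nonneg_right hlogR (by linarith)
  unfold contextTime
  split_ifs with h
  · have hlog2 : Real.log 2 ≤ Real.log N := Real.log_le_log (by norm_num) (by exact_mod_cast h)
    have h2 := Real.log_two_gt_d9
    have hq' : 0 < 1 / q := by positivity
    have h3 : (1 + Real.log (min R N : ℕ)) * (1 / q * R) ≤ (3 * Real.log N) * (1 / q * R) :=
      mul_le_mul_of_nonneg_right (by linarith) (by positivity)
    have h4 : (1 + Real.log (min R N : ℕ)) * (1 / q * Real.log N) ≤ R * (1 / q * Real.log N) :=
      mul_le_mul_of_nonneg_right hlogR (mul_nonneg hq'.le (by linarith))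
    nlinarith [mul_nonneg (by linarith : (0 : ℝ) ≤ R) (by linarith : (0 : ℝ) ≤ R)]
  · have h5 : N = 1 := by omega
    subst h5
    simp only [Nat.cast_one, Real.log_one, mul_zero, zero_add, add_zero]
    nlinarith

omit [NeZero R] [NeZero K] in
-- For R ≤ N the logarithmic factor is at most R and the ceiling at most 2N/R; for R ≥ N the ceiling
-- is at most 1 and the factor at most N.
theorem ceil_mul_one_add_log_le (hN : 1 ≤ N) (hR : 1 ≤ R) :
    (⌈(N : ℝ) / R⌉₊ : ℝ) * (1 + Real.log (min R N : ℕ)) ≤ 2 * N := by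
  have hR0 : (0 : ℝ) < R := by exact_mod_cast hR
  have hlog := one_add_log_natCast_le (by omega : 1 ≤ min R N)
  have hlog0 := Real.log_natCast_nonneg (min R N)
  rcases le_total R N with h | h
  · rw [min_eq_left h] at hlog hlog0 ⊢
    have h1 : (⌈(N : ℝ) / R⌉₊ : ℝ) ≤ N / R + 1 := (Nat.ceil_lt_add_one (by positivity)).le
    have h2 : (1 : ℝ) ≤ N / R := by rw [le_div_iff₀ hR0, one_mul]; exact_mod_cast h
    calc (⌈(N : ℝ) / R⌉₊ : ℝ) * (1 + Real.log R) ≤ (2 * (N / R)) * R :=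
          mul_le_mul (by linarith) hlog (by linarith) (by positivity)
      _ = 2 * N := by field_simp
  · rw [min_eq_right h] at hlog hlog0 ⊢
    have h1 : ⌈(N : ℝ) / R⌉₊ ≤ 1 := by
      rw [Nat.ceil_le, div_le_iff₀ hR0]
      simpa using (by exact_mod_cast h : (N : ℝ) ≤ R)
    have h2 : (⌈(N : ℝ) / R⌉₊ : ℝ) ≤ 1 := by exact_mod_cast h1
    calc (⌈(N : ℝ) / R⌉₊ : ℝ) * (1 + Real.log N) ≤ 1 * N :=
          mul_le_mul h2 hlog (by linarith) (by norm_num)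
      _ ≤ 2 * N := by linarith [(Nat.cast_nonneg N : (0 : ℝ) ≤ N)]

omit [NeZero R] in
theorem contextTime_le {q : ℝ} (hq : 0 < q) (hq1 : q ≤ 1) :
    contextTime N R q ≤ 2 / q * (Real.log N + R) := by
  have hlog := Real.log_natCast_nonneg N
  have hR : (0 : ℝ) ≤ R := Nat.cast_nonneg R
  have h1 : 1 ≤ 1 / q := by rw [le_div_iff₀ hq]; linarith
  have h2 : 2 / q = 2 * (1 / q) := by ring
  rw [h2, contextTime]
  split_ifs <;> nlinarith [mul_nonneg (by linarith : 0 ≤ 1 / q) hlog,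
    mul_nonneg (by linarith : 0 ≤ 1 / q - 1) hR]

end AllocationGame

/-! ### The two bounds -/

open AllocationGame in
theorem mainTheorem2 :
    (∃ C : ℝ, 0 < C ∧ ∀ (N R K : ℕ) [NeZero R] [NeZero K] (p : unitInterval) (ζ : ℝ),
      1 ≤ N → 0 < (p : ℝ) → (p : ℝ) < 1 → ζ < 0 →
      expectedSteps N R K p ζ ≤ ENNReal.ofReal
        (C * ((K * Real.log K + 2 * K) * R * ((2 - p) / (2 * (1 - p))) *
          ((1 / p) * Real.log N + R) + 1))) ∧
    (∀ p : unitInterval, 0 < (p : ℝ) → (p : ℝ) < 1 →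
      ∃ C : ℝ, 0 < C ∧ ∀ (N R K : ℕ) [NeZero R] [NeZero K] (ζ : ℝ),
        1 ≤ N → K = ⌈(N : ℝ) / (R : ℝ)⌉₊ → ζ < 0 →
        expectedSteps N R K p ζ ≤ ENNReal.ofReal
          (C * (N * (Real.log ⌈(N : ℝ) / (R : ℝ)⌉₊ + 1) * (Real.log N + R)))) := by
  -- 2880 = 720 · 4, with 720 from `expectedSteps_le`. The 4 is that of `contextTime_mul_le` in the
  -- first bound, and in the second the product of the 2 in `ceil_mul_one_add_log_le` and the 2 in
  -- `contextTime_le`.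
  refine ⟨⟨2880, by norm_num, fun N R K _ _ p ζ hN hp0 hp1 hζ => ?_⟩, fun p hp0 hp1 =>
    ⟨2880 * ((2 - p) / (2 * (1 - p))) / p, ?_, fun N R K _ _ ζ hN hK hζ => ?_⟩⟩
  · refine (expectedSteps_le hζ hN hp0 hp1).trans (ENNReal.ofReal_le_ofReal ?_)
    have h1 := contextTime_mul_le hN (Nat.pos_of_ne_zero (NeZero.ne R)) hp0
    have hlogK := Real.log_natCast_nonneg K
    have hlogN := Real.log_natCast_nonneg N
    have hα : 0 ≤ (2 - (p : ℝ)) / (2 * (1 - p)) := div_nonneg (by linarith) (by linarith)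
    have h2 : 0 ≤ 720 * K * (1 + Real.log K) * ((2 - (p : ℝ)) / (2 * (1 - p))) := by positivity
    have h3 := mul_le_mul_of_nonneg_left h1 h2
    have h4 : 0 ≤ (K : ℝ) * ((2 - (p : ℝ)) / (2 * (1 - p))) *
        (R * (1 / p * Real.log N + R)) := by positivity
    linarith
  · have : 0 < (2 - (p : ℝ)) / (2 * (1 - p)) := div_pos (by linarith) (by linarith)
    positivity
  · refine (expectedSteps_le hζ hN hp0 hp1).trans (ENNReal.ofReal_le_ofReal ?_)
    have h1 := ceil_mul_one_add_log_le hN (Nat.pos_of_ne_zero (NeZero.ne R))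
    rw [← hK] at h1 ⊢
    have hlogK := Real.log_natCast_nonneg K
    have hlogN := Real.log_natCast_nonneg N
    have h2 := contextTime_le (N := N) (R := R) hp0 hp1.le
    have hα : 0 ≤ (2 - (p : ℝ)) / (2 * (1 - p)) := div_nonneg (by linarith) (by linarith)
    have h3 : 0 ≤ contextTime N R p := by
      unfold contextTime
      split_ifs <;> positivity
    have h4 := mul_le_mul h1 h2 h3 (by positivity)
    have h5 : 0 ≤ 720 * (1 + Real.log K) * ((2 - (p : ℝ)) / (2 * (1 - p))) := by positivity
    have h6 := mul_le_mul_of_nonneg_left h4 h5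
    refine le_trans (le_of_eq ?_) (h6.trans (le_of_eq ?_))
    · ring
    · ring
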